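/- **Setting.** Let $n,m\ge 1$, $A\in\mathbb R^{n\times n}$, $B\in\mathbb R^{n\times m}$, and let $Q\in\mathbb R^{n\times n}$, $R\in\mathbb R^{m\times m}$ be symmetric positive definite. Let $x_0$ be a random vector in $\mathbb R^n$ with finite second moments and positive definite $\Sigma_0=\mathbb E\,x_0x_0^{\mathsf T}$. For a gain $K\in\mathbb R^{m\times n}$ let $x_{t+1}=Ax_t+Bu_t$, $u_t=-Kx_t$, and $$J(K)=\mathbb E\sum_{t=0}^\infty\bigl(x_t^{\mathsf T}Qx_t+u_t^{\mathsf T}Ru_t\bigr),\qquad \Sigma_K=\mathbb E\sum_{t=0}^\infty x_tx_t^{\mathsf T},\qquad \mathcal K=\{K:\rho(A-BK)<1\},$$ where $\rho$ is the spectral radius. Let $\nabla J$ be the gradient for the Frobenius inner product, $\|\cdot\|_F$ the Frobenius norm, $\|\cdot\|$ and $\sigma_{\min}$ the largest and the smallest singular value. An optimal gain is a minimizer $K^*$ of $J$ over $\mathcal K$. **Theorem.** 0. For every $K\in\mathcal K$ the cost $J(K)$ is finite, the Lyapunov equation $(A-BK)^{\mathsf T}P(A-BK)+Q+K^{\mathsf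 T}RK=P$ has a unique solution $P_K$, and $J(K)=\operatorname{tr}(P_K\Sigma_0)$. 1. $J$ is real analytic on $\mathcal K$, hence twice continuously differentiable. 2. $J$ is coercive on $\mathcal K$: for every sequence $(K^l)$ in $\mathcal K$ with $\|K^l\|\to\infty$, or with $K^l$ converging to a point of $\partial\mathcal K$, one has $J(K^l)\to+\infty$. If $\mathcal K\ne\emptyset$, an optimal gain exists. 3. For every optimal gain $K^*$, $J$ is gradient dominant of degree $2$ with constant $$\mu=\frac{2\,\sigma_{\min}(\Sigma_0)^2\,\sigma_{\min}(R)}{\|\Sigma_{K^*}\|}>0,\qquad\text{that is,}\qquad J(K)-J(K^*)\le\frac1{2\mu}\|\nabla J(K)\|_F^2\quad\text{for all }K\in\mathcal K.$$ 4. Let $K^0\in\mathcal K$ and $\mathcal K_0=\{K\in\mathcal K: J(K)\le J(K^0)\}$. Call $L>0$ a smoothness constant of $J$ on $\mathcal K_0$ if $J(K')\le J(K)+\langle\nabla J(K),K'-K\rangle+\frac L2\|K'-K\|_F^2$ for all $K,K'$ whose joining segment lies in $\mathcal K_0$. Such a constant exists. For every smoothness constant $L_{K^0}$ of $J$ on $\mathcal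 K_0$ and every step size $0<\alpha\le 1/L_{K^0}$, the iterates $K^{k+1}=K^k-\alpha\nabla J(K^k)$ satisfy: (i) $K^k\in\mathcal K$ for all $k$; (ii) for every optimal gain $K^*$, with $\mu$ as in 3, $K^k\to K^*$ and $$J(K^k)-J(K^*)\le(1-\mu\alpha)^k\bigl(J(K^0)-J(K^*)\bigr)\quad\text{for all }k\ge 0.$$ -/

import Mathlib

open MeasureTheory Filter Topology Matrix

-- Gain matrices carry the Frobenius norm.
attribute [local instance] Matrix.frobeniusNormedAddCommGroup Matrix.frobeniusNormedSpace

noncomputable section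

/-- Largest singular value (spectral norm) of a real matrix. Mathlib lists the singular values of a
linear map in decreasing order, starting with index `0`. -/
def sigmaMax {p q : ℕ} (M : Matrix (Fin p) (Fin q) ℝ) : ℝ :=
  (Matrix.toEuclideanLin M).singularValues 0

/-- Smallest singular value of a real square matrix of size `d ≥ 1`: the `d`-th one in decreasing
order. -/
def sigmaMin {d : ℕ} (M : Matrix (Fin d) (Fin d) ℝ) : ℝ :=
  (Matrix.toEuclideanLin M).singularValues (d - 1)

/-- The Euclidean (Frobenius) gradient of a function of a matrix: the matrix of its partial
derivatives. -/
def matrixGrad {m n : ℕ} (J : Matrix (Fin m) (Fin n) ℝ → ℝ) (K : Matrix (Fin m) (Fin n) ℝ) :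
    Matrix (Fin m) (Fin n) ℝ :=
  Matrix.of fun i j => fderiv ℝ J K (Matrix.single i j 1)

/-- `Kstar` is an optimal solution of minimizing `J` over `S`. -/
def IsOptimal {m n : ℕ} (J : Matrix (Fin m) (Fin n) ℝ → ℝ) (S : Set (Matrix (Fin m) (Fin n) ℝ))
    (Kstar : Matrix (Fin m) (Fin n) ℝ) : Prop :=
  Kstar ∈ S ∧ IsMinOn J S Kstar

/-- Coercivity of `J` on `S`: along every sequence in `S`, `J` tends to `+∞` if the spectral norm
tends to `+∞`, or if the sequence converges to a point of the boundary of `S`. -/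
def IsCoerciveOn {m n : ℕ} (J : Matrix (Fin m) (Fin n) ℝ → ℝ)
    (S : Set (Matrix (Fin m) (Fin n) ℝ)) : Prop :=
  ∀ K : ℕ → Matrix (Fin m) (Fin n) ℝ, (∀ l, K l ∈ S) →
    (Tendsto (fun l => sigmaMax (K l)) atTop atTop ∨ ∃ Kb ∈ frontier S, Tendsto K atTop (𝓝 Kb)) →
    Tendsto (fun l => J (K l)) atTop atTop

/-- `μ`-gradient dominance of degree `p` on `S`, relative to an optimal solution `Kstar`. -/
structure IsGradientDominant {m n : ℕ} (J : Matrix (Fin m) (Fin n) ℝ → ℝ)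
    (S : Set (Matrix (Fin m) (Fin n) ℝ)) (Kstar : Matrix (Fin m) (Fin n) ℝ) (μ : ℝ) (p : ℕ) :
    Prop where
  pos : 0 < μ
  optimal : IsOptimal J S Kstar
  contDiffOn : ContDiffOn ℝ 1 J S
  bound : ∀ K ∈ S, J K - J Kstar ≤ 1 / (2 * μ) * ‖matrixGrad J K‖ ^ p

/-- The sublevel set of level `γ` of `J` over `S`. -/
def sublevelSet {m n : ℕ} (J : Matrix (Fin m) (Fin n) ℝ → ℝ) (S : Set (Matrix (Fin m) (Fin n) ℝ))
    (γ : ℝ) : Set (Matrix (Fin m) (Fin n) ℝ) :=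
  {K | K ∈ S ∧ J K ≤ γ}

/-- `L > 0` is a smoothness constant of `J` on `S`: the quadratic upper bound with constant `L`
holds between any two points whose joining segment lies in `S`. Here `trace (Gᵀ * H)` is the
Frobenius inner product. -/
structure IsSmoothnessConstant {m n : ℕ} (J : Matrix (Fin m) (Fin n) ℝ → ℝ)
    (S : Set (Matrix (Fin m) (Fin n) ℝ)) (L : ℝ) : Prop where
  pos : 0 < L
  bound : ∀ K K' : Matrix (Fin m) (Fin n) ℝ,
    (∀ t ∈ Set.Icc (0 : ℝ) 1, t • K + (1 - t) • K' ∈ S) →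
    J K' ≤ J K + ((matrixGrad J K)ᵀ * (K' - K)).trace + L / 2 * ‖K' - K‖ ^ 2

/-- Data of a discrete-time LQR problem with `n` states and `m` inputs: the dynamics
`x_{t+1} = A x_t + B u_t`, the cost weights `Q`, `R`, and the law of the initial state `x_0`. -/
structure LQRProblem (n m : ℕ) where
  A : Matrix (Fin n) (Fin n) ℝ
  B : Matrix (Fin n) (Fin m) ℝ
  Q : Matrix (Fin n) (Fin n) ℝ
  R : Matrix (Fin m) (Fin m) ℝ
  law : Measure (Fin n → ℝ)

namespace LQRProblem

variable {n m : ℕ} (S : LQRProblem n m)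

/-- The closed-loop state `x_t` under `u_t = -K x_t`, started at `x₀`. -/
def state (K : Matrix (Fin m) (Fin n) ℝ) (x₀ : Fin n → ℝ) : ℕ → (Fin n → ℝ)
  | 0 => x₀
  | t + 1 => S.A *ᵥ state K x₀ t + S.B *ᵥ (-(K *ᵥ state K x₀ t))

/-- The input `u_t = -K x_t`. -/
def input (K : Matrix (Fin m) (Fin n) ℝ) (x₀ : Fin n → ℝ) (t : ℕ) : Fin m → ℝ :=
  -(K *ᵥ S.state K x₀ t)

/-- The stage cost `x_tᵀ Q x_t + u_tᵀ R u_t`. -/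
def stageCost (K : Matrix (Fin m) (Fin n) ℝ) (x₀ : Fin n → ℝ) (t : ℕ) : ℝ :=
  S.state K x₀ t ⬝ᵥ (S.Q *ᵥ S.state K x₀ t) + S.input K x₀ t ⬝ᵥ (S.R *ᵥ S.input K x₀ t)

/-- The LQR cost `J(K) = E ∑_t (x_tᵀ Q x_t + u_tᵀ R u_t)`. -/
def cost (K : Matrix (Fin m) (Fin n) ℝ) : ℝ :=
  ∫ x₀, ∑' t, S.stageCost K x₀ t ∂S.law

/-- The stabilizing gains: the (complex) spectral radius of `A - BK` is less than `1`. -/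
def stabilizing : Set (Matrix (Fin m) (Fin n) ℝ) :=
  {K | spectralRadius ℂ ((S.A - S.B * K).map (fun r : ℝ => (r : ℂ))) < 1}

/-- `Σ₀ = E x₀ x₀ᵀ`. -/
def Sigma0 : Matrix (Fin n) (Fin n) ℝ :=
  Matrix.of fun i j => ∫ x₀, x₀ i * x₀ j ∂S.law

/-- The state correlation matrix `Σ_K = E ∑_t x_t x_tᵀ`. -/
def SigmaK (K : Matrix (Fin m) (Fin n) ℝ) : Matrix (Fin n) (Fin n) ℝ :=
  Matrix.of fun i j => ∫ x₀, ∑' t, S.state K x₀ t i * S.state K x₀ t j ∂S.law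

/-- `P` solves the Lyapunov equation `(A - BK)ᵀ P (A - BK) + Q + Kᵀ R K = P`. -/
def IsLyapunovSolution (K : Matrix (Fin m) (Fin n) ℝ) (P : Matrix (Fin n) (Fin n) ℝ) : Prop :=
  (S.A - S.B * K)ᵀ * P * (S.A - S.B * K) + S.Q + Kᵀ * S.R * K = P

/-- The constant `2 σ_min(Σ₀)² σ_min(R) / ‖Σ_{K*}‖`. -/
def mu (Kstar : Matrix (Fin m) (Fin n) ℝ) : ℝ :=
  2 * sigmaMin S.Sigma0 ^ 2 * sigmaMin S.R / sigmaMax (S.SigmaK Kstar)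

end LQRProblem

end

/-!
Write `M = A - BK`. By Gelfand's formula `K` is stabilizing exactly if some power of `M` has Frobenius
norm less than `1` (`isSchurStable_iff_exists_norm_pow_lt_one`); this is an open condition, and it
makes the series `∑ₜ (Mᵗ)ᵀ C Mᵗ` converge to the unique solution of `Mᵀ P M + C = P`. Taking
`C = Q + Kᵀ R K` gives `J(K) = tr (P_K Σ₀)`, and the adjoint equation gives `Σ_K` and
`J(K) = tr ((Q + Kᵀ R K) Σ_K)`. The solution of the Lyapunov equation is analytic in the data because
inversion of bounded operators is (`AnalyticAt.of_sub_mul_mul_eq`).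

Coercivity rests on two lower bounds. Since `Σ_K ≥ Σ₀`, the cost is at least a multiple of `‖K‖²`.
It is also at least a multiple of `∑ₜ ‖Mᵗ‖²`, of which every term with `t ≥ 1` is at least `1` at a
boundary point, so that partial sums, which are continuous in `K`, are arbitrarily large nearby. Hence
sublevel sets are compact, an optimal gain exists, and the second derivative is bounded on sublevel
sets, which yields a smoothness constant.

The key identity (`LQRProblem.cost_sub_cost`) is, with `Δ = K' - K` and
`E_K = R K - Bᵀ P_K (A - B K)`,

  `J(K') - J(K) = 2 tr (Δᵀ E_K Σ_{K'}) + tr (Δᵀ (R + Bᵀ P_K B) Δ Σ_{K'})`.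

Letting `K'` tend to `K` it gives `∇J(K) = 2 E_K Σ_K`. With `K' = K*`, completing the square gives
`σ_min(R) (J(K) - J(K*)) ≤ ‖Σ_{K*}‖ ‖E_K‖²`, and `‖∇J(K)‖ ≥ 2 σ_min(Σ₀) ‖E_K‖` turns this into
gradient dominance. At an optimal gain `E` vanishes, and the identity becomes quadratic growth, so
that convergence of the values implies convergence of the gains.

For gradient descent, the quadratic upper bound is available only along segments inside the sublevel
set. A first-exit argument (`descent_step`) shows that the whole step stays there: as long as the
segment does, the bound makes the value at its end strictly smaller than at its start. Combined with
gradient dominance, each step contracts the suboptimality gap by the factor `1 - μ α`.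
-/

attribute [local instance] Matrix.frobeniusNormedRing Matrix.frobeniusNormedAlgebra

/-! ### Traces of products of positive semidefinite matrices -/

theorem Matrix.PosSemidef.trace_mul_nonneg {p : ℕ} {X Y : Matrix (Fin p) (Fin p) ℝ}
    (hX : X.PosSemidef) (hY : Y.PosSemidef) : 0 ≤ (X * Y).trace := by
  obtain ⟨k, v, rfl⟩ := posSemidef_iff_eq_sum_vecMulVec.mp hX
  rw [Finset.sum_mul, trace_sum]
  refine Finset.sum_nonneg fun i _ => ?_
  rw [vecMulVec_mul, trace_vecMulVec, dotProduct_comm, ← dotProduct_mulVec]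
  exact hY.dotProduct_mulVec_nonneg _

theorem Matrix.PosSemidef.trace_mul_le_trace_mul {p : ℕ} {X Y Z : Matrix (Fin p) (Fin p) ℝ}
    (hXY : (Y - X).PosSemidef) (hZ : Z.PosSemidef) : (X * Z).trace ≤ (Y * Z).trace := by
  have h := hXY.trace_mul_nonneg hZ
  rw [Matrix.sub_mul, trace_sub] at h
  linarith

theorem trace_transpose_mul_eq_sum {p q : ℕ} (M N : Matrix (Fin p) (Fin q) ℝ) :
    (Mᵀ * N).trace = ∑ i, ∑ j, M i j * N i j := by
  simp only [trace, diag_apply, mul_apply, transpose_apply]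
  exact Finset.sum_comm

theorem frobenius_norm_sq {p q : ℕ} (M : Matrix (Fin p) (Fin q) ℝ) :
    ‖M‖ ^ 2 = (Mᵀ * M).trace := by
  rw [trace_transpose_mul_eq_sum, frobenius_norm_def, ← Real.rpow_natCast, ← Real.rpow_mul]
  · simp [sq]
  · positivity

theorem posSemidef_transpose_mul_self {p q : ℕ} (M : Matrix (Fin p) (Fin q) ℝ) :
    (Mᵀ * M).PosSemidef := by
  simpa using posSemidef_conjTranspose_mul_self M

theorem Matrix.PosSemidef.transpose_mul_mul {p q : ℕ} {X : Matrix (Fin p) (Fin p) ℝ}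
    (hX : X.PosSemidef) (N : Matrix (Fin p) (Fin q) ℝ) : (Nᵀ * X * N).PosSemidef := by
  simpa using hX.conjTranspose_mul_mul_same N

/-- If `X ≥ s`, then right multiplication by `X` increases the Frobenius norm at least by the
factor `s`. -/
theorem mul_norm_le_norm_mul {p q : ℕ} {X : Matrix (Fin q) (Fin q) ℝ} {s : ℝ} (hs : 0 ≤ s)
    (hX : (X - s • (1 : Matrix (Fin q) (Fin q) ℝ)).PosSemidef) (E : Matrix (Fin p) (Fin q) ℝ) :
    s * ‖E‖ ≤ ‖E * X‖ := by
  set Y := X - s • (1 : Matrix (Fin q) (Fin q) ℝ) with hY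
  have hXY : E * X = s • E + E * Y := by simp [hY, Matrix.mul_sub]
  have hYt : Yᵀ = Y := by simpa using hX.isHermitian.eq
  have h1 : (0 : ℝ) ≤ (Y * (Eᵀ * E)).trace := hX.trace_mul_nonneg (posSemidef_transpose_mul_self E)
  have h2 : (Eᵀ * (E * Y)).trace = (Y * (Eᵀ * E)).trace := by
    rw [← Matrix.mul_assoc, trace_mul_comm]
  have h3 : ((E * Y)ᵀ * E).trace = (Y * (Eᵀ * E)).trace := by
    rw [transpose_mul, hYt, Matrix.mul_assoc]
  have h4 : ‖E * X‖ ^ 2 = (s * ‖E‖) ^ 2 + 2 * s * (Y * (Eᵀ * E)).trace + ‖E * Y‖ ^ 2 := by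
    rw [hXY, frobenius_norm_sq, mul_pow, frobenius_norm_sq, frobenius_norm_sq (E * Y)]
    simp only [transpose_add, transpose_smul, Matrix.add_mul, Matrix.mul_add, Matrix.smul_mul,
      Matrix.mul_smul, trace_add, trace_smul, h2, h3, smul_eq_mul]
    ring
  refine le_of_sq_le_sq ?_ (norm_nonneg _)
  rw [h4]
  have := mul_nonneg hs h1
  nlinarith [sq_nonneg ‖E * Y‖]

/-! ### Singular values of symmetric matrices -/

theorem adjoint_comp_toEuclideanLin_apply {p q : ℕ} (M : Matrix (Fin p) (Fin q) ℝ)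
    (v : EuclideanSpace ℝ (Fin q)) :
    ((toEuclideanLin M).adjoint ∘ₗ toEuclideanLin M) v
      = WithLp.toLp 2 (Mᵀ *ᵥ (M *ᵥ v.ofLp)) := by
  rw [← toEuclideanLin_conjTranspose_eq_adjoint]
  simp [toLpLin_apply]

/-- The absolute value of every eigenvalue of a symmetric matrix is a singular value. -/
theorem exists_singularValues_eq_abs {d : ℕ} {M : Matrix (Fin d) (Fin d) ℝ}
    (hM : M.IsHermitian) {l : ℝ} {v : Fin d → ℝ} (hv : v ≠ 0) (h : M *ᵥ v = l • v) :
    ∃ j < d, (toEuclideanLin M).singularValues j = |l| := by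
  have hMt : Mᵀ = M := by simpa using hM.eq
  have he : Module.End.HasEigenvalue ((toEuclideanLin M).adjoint ∘ₗ toEuclideanLin M) (l ^ 2) := by
    refine Module.End.hasEigenvalue_of_hasEigenvector (x := WithLp.toLp 2 v) ⟨?_, ?_⟩
    · rw [Module.End.mem_eigenspace_iff, adjoint_comp_toEuclideanLin_apply, hMt]
      simp [h, mulVec_smul, smul_smul, sq]
    · simpa using hv
  have hd : Module.finrank ℝ (EuclideanSpace ℝ (Fin d)) = d := by simp
  obtain ⟨j, hj⟩ :=
    (toEuclideanLin M).isSymmetric_adjoint_comp_self.exists_eigenvalues_eq hd he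
  refine ⟨j, j.2, ?_⟩
  rw [LinearMap.singularValues_fin _ hd, ← Real.sqrt_sq_eq_abs]
  congr 1

theorem sigmaMin_le_abs {d : ℕ} {M : Matrix (Fin d) (Fin d) ℝ}
    (hM : M.IsHermitian) {l : ℝ} {v : Fin d → ℝ} (hv : v ≠ 0) (h : M *ᵥ v = l • v) :
    sigmaMin M ≤ |l| := by
  obtain ⟨j, hj, e⟩ := exists_singularValues_eq_abs hM hv h
  exact e ▸ (toEuclideanLin M).singularValues_antitone (by omega)

theorem abs_le_sigmaMax {d : ℕ} {M : Matrix (Fin d) (Fin d) ℝ}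
    (hM : M.IsHermitian) {l : ℝ} {v : Fin d → ℝ} (hv : v ≠ 0) (h : M *ᵥ v = l • v) :
    |l| ≤ sigmaMax M := by
  obtain ⟨j, hj, e⟩ := exists_singularValues_eq_abs hM hv h
  exact e ▸ (toEuclideanLin M).singularValues_antitone (by omega)

/-- A symmetric matrix all of whose eigenvalues are nonnegative is positive semidefinite. -/
theorem posSemidef_of_forall_eigenvector {d : ℕ} {M : Matrix (Fin d) (Fin d) ℝ}
    (hM : M.IsHermitian) (h : ∀ (l : ℝ) (v : Fin d → ℝ), v ≠ 0 → M *ᵥ v = l • v → 0 ≤ l) :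
    M.PosSemidef := by
  rw [hM.posSemidef_iff_eigenvalues_nonneg]
  intro i
  refine h _ (hM.eigenvectorBasis i).ofLp ?_ (hM.mulVec_eigenvectorBasis i)
  have := hM.eigenvectorBasis.orthonormal.ne_zero i
  simpa using this

theorem isHermitian_smul_one {d : ℕ} (c : ℝ) :
    (c • (1 : Matrix (Fin d) (Fin d) ℝ)).IsHermitian := by
  simp [IsHermitian]

/-- `M ≥ σ_min(M)` for a positive definite matrix `M`. -/
theorem Matrix.PosDef.posSemidef_sub_sigmaMin {d : ℕ} {M : Matrix (Fin d) (Fin d) ℝ}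
    (hM : M.PosDef) : (M - sigmaMin M • (1 : Matrix (Fin d) (Fin d) ℝ)).PosSemidef := by
  refine posSemidef_of_forall_eigenvector (hM.isHermitian.sub (isHermitian_smul_one _)) ?_
  intro l v hv h
  have h' : M *ᵥ v = (l + sigmaMin M) • v := by
    rw [sub_mulVec, smul_mulVec, one_mulVec, sub_eq_iff_eq_add] at h
    rw [h, add_smul]
  have h1 := sigmaMin_le_abs hM.isHermitian hv h'
  have h2 : 0 < v ⬝ᵥ (M *ᵥ v) := by simpa using hM.dotProduct_mulVec_pos hv
  rw [h', dotProduct_smul, smul_eq_mul] at h2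
  have h3 : 0 < l + sigmaMin M :=
    pos_of_mul_pos_left h2 (by simpa using dotProduct_star_self_nonneg v)
  rw [abs_of_pos h3] at h1
  linarith

/-- `M ≤ σ_max(M)` for a symmetric matrix `M`. -/
theorem Matrix.IsHermitian.posSemidef_sigmaMax_sub {d : ℕ} {M : Matrix (Fin d) (Fin d) ℝ}
    (hM : M.IsHermitian) : (sigmaMax M • (1 : Matrix (Fin d) (Fin d) ℝ) - M).PosSemidef := by
  refine posSemidef_of_forall_eigenvector ((isHermitian_smul_one _).sub hM) ?_
  intro l v hv h
  have h' : M *ᵥ v = (sigmaMax M - l) • v := by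
    rw [sub_mulVec, smul_mulVec, one_mulVec, sub_eq_iff_eq_add] at h
    rw [sub_smul, h, add_sub_cancel_left]
  linarith [(le_abs_self _).trans (abs_le_sigmaMax hM hv h')]

theorem Matrix.PosDef.sigmaMin_pos {d : ℕ} (hd : 0 < d) {M : Matrix (Fin d) (Fin d) ℝ}
    (hM : M.PosDef) : 0 < sigmaMin M := by
  have hinj : Function.Injective (toEuclideanLin M) := by
    refine (injective_iff_map_eq_zero _).2 fun v hv => ?_
    by_contra hne
    have h2 := hM.dotProduct_mulVec_pos (x := v.ofLp) (by simpa using hne)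
    have h3 : M *ᵥ v.ofLp = 0 := by simpa [toLpLin_apply] using hv
    simp [h3] at h2
  exact (LinearMap.injective_iff_forall_lt_finrank_singularValues_pos _).1 hinj (d - 1)
    (by simpa using hd)

theorem Matrix.PosDef.sigmaMax_pos {d : ℕ} (hd : 0 < d) {M : Matrix (Fin d) (Fin d) ℝ}
    (hM : M.PosDef) : 0 < sigmaMax M :=
  (hM.sigmaMin_pos hd).trans_le ((toEuclideanLin M).singularValues_antitone (Nat.zero_le _))

/-- The spectral norm is at most the Frobenius norm. -/
theorem sigmaMax_le_norm {p q : ℕ} (M : Matrix (Fin p) (Fin q) ℝ) : sigmaMax M ≤ ‖M‖ := by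
  rcases Nat.eq_zero_or_pos q with hq | hq
  · subst hq
    unfold sigmaMax
    rw [LinearMap.singularValues_of_finrank_le _ (by simp)]
    exact norm_nonneg _
  obtain ⟨v, hv⟩ := (LinearMap.hasEigenvalue_adjoint_comp_self_sq_singularValues
    (toEuclideanLin M) (n := 0) (by simpa using hq)).exists_hasEigenvector
  have h1 : inner ℝ (((toEuclideanLin M).adjoint ∘ₗ toEuclideanLin M) v) v
      = sigmaMax M ^ 2 * ‖v‖ ^ 2 := by
    rw [hv.apply_eq_smul, inner_smul_left, real_inner_self_eq_norm_sq]
    rfl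
  rw [LinearMap.comp_apply, LinearMap.adjoint_inner_left, real_inner_self_eq_norm_sq] at h1
  have h2 : ‖toEuclideanLin M v‖ ≤ ‖M‖ * ‖v‖ := by
    have h := frobenius_norm_mul M (replicateCol Unit v.ofLp)
    rw [← replicateCol_mulVec, frobenius_norm_replicateCol, frobenius_norm_replicateCol] at h
    simpa [toLpLin_apply] using h
  have hv0 : 0 < ‖v‖ := norm_pos_iff.2 hv.2
  have h3 : (sigmaMax M * ‖v‖) ^ 2 ≤ (‖M‖ * ‖v‖) ^ 2 := by
    rw [mul_pow, ← h1]
    gcongr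
  exact le_of_mul_le_mul_right (le_of_sq_le_sq h3 (by positivity)) hv0

/-! ### Schur stable matrices -/

/-- A real square matrix is Schur stable if all its complex eigenvalues lie in the open unit
disc. -/
def IsSchurStable {n : ℕ} (M : Matrix (Fin n) (Fin n) ℝ) : Prop :=
  spectralRadius ℂ (M.map (fun r : ℝ => (r : ℂ))) < 1

theorem norm_map_ofReal_pow {n : ℕ} (M : Matrix (Fin n) (Fin n) ℝ) (k : ℕ) :
    ‖(M.map (fun r : ℝ => (r : ℂ))) ^ k‖ = ‖M ^ k‖ := by
  have h : (M.map (fun r : ℝ => (r : ℂ))) ^ k = (M ^ k).map (fun r : ℝ => (r : ℂ)) :=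
    (Matrix.map_pow M Complex.ofRealHom k).symm
  rw [h, frobenius_norm_map_eq _ _ (by simp)]

/-- By Gelfand's formula the powers of a Schur stable matrix decay geometrically. -/
theorem IsSchurStable.exists_eventually_norm_pow_le {n : ℕ} {M : Matrix (Fin n) (Fin n) ℝ}
    (hM : IsSchurStable M) :
    ∃ r : ℝ, 0 ≤ r ∧ r < 1 ∧ ∀ᶠ t : ℕ in atTop, ‖M ^ t‖ ≤ r ^ t := by
  have : CompleteSpace (Matrix (Fin n) (Fin n) ℂ) := FiniteDimensional.complete ℂ _
  obtain ⟨r, h1, h2⟩ := ENNReal.lt_iff_exists_nnreal_btwn.1 hM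
  refine ⟨r, r.2, by exact_mod_cast h2, ?_⟩
  have hG := spectrum.pow_nnnorm_pow_one_div_tendsto_nhds_spectralRadius
    (M.map (fun r : ℝ => (r : ℂ)))
  filter_upwards [hG.eventually (gt_mem_nhds h1), eventually_gt_atTop 0] with t ht ht0
  have hlt := ENNReal.pow_lt_pow_left ht0.ne' ht
  rw [one_div, ENNReal.rpow_inv_natCast_pow ht0.ne' _] at hlt
  have h3 : ‖(M.map (fun r : ℝ => (r : ℂ))) ^ t‖₊ < r ^ t := by exact_mod_cast hlt
  rw [← norm_map_ofReal_pow]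
  exact_mod_cast h3.le

/-- Schur stability as an open condition on the real matrix, without reference to the spectrum. -/
theorem isSchurStable_iff_exists_norm_pow_lt_one {n : ℕ} (hn : 0 < n)
    {M : Matrix (Fin n) (Fin n) ℝ} : IsSchurStable M ↔ ∃ k : ℕ, ‖M ^ (k + 1)‖ < 1 := by
  constructor
  · intro hM
    obtain ⟨r, hr0, hr1, h⟩ := hM.exists_eventually_norm_pow_le
    obtain ⟨t, ht, ht0⟩ := (h.and (eventually_gt_atTop 0)).exists
    obtain ⟨k, rfl⟩ : ∃ k, t = k + 1 := ⟨t - 1, by omega⟩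
    exact ⟨k, ht.trans_lt (pow_lt_one₀ hr0 hr1 (by omega))⟩
  · -- The Frobenius norm of `1` is `√n`, so the bound of the spectral radius by roots of norms of
    -- powers is not sharp; instead `1 - z⁻⁽ᵏ⁺¹⁾ aᵏ⁺¹` is inverted for `|z| ≥ 1`.
    rintro ⟨k, hk⟩
    have : CompleteSpace (Matrix (Fin n) (Fin n) ℂ) := FiniteDimensional.complete ℂ _
    have : Nonempty (Fin n) := ⟨⟨0, hn⟩⟩
    have : Nontrivial (Matrix (Fin n) (Fin n) ℂ) := inferInstance
    rw [← norm_map_ofReal_pow] at hk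
    unfold IsSchurStable
    set a := M.map (fun r : ℝ => (r : ℂ)) with ha
    refine (spectrum.spectralRadius_lt_of_forall_lt a (r := 1) ?_)
    intro z hz
    by_contra hz1
    have hz1' : 1 ≤ ‖z‖ := by exact_mod_cast not_lt.1 hz1
    have hz0 : z ≠ 0 := by rintro rfl; simp at hz1'; linarith
    have hmem : z ^ (k + 1) ∈ spectrum ℂ (a ^ (k + 1)) :=
      spectrum.pow_image_subset a (k + 1) ⟨z, hz, rfl⟩
    refine hmem ?_
    have hw : z ^ (k + 1) ≠ 0 := pow_ne_zero _ hz0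
    have hu : IsUnit (1 - (z ^ (k + 1))⁻¹ • a ^ (k + 1)) := by
      refine isUnit_one_sub_of_norm_lt_one ?_
      rw [norm_smul, norm_inv, norm_pow]
      refine lt_of_le_of_lt ?_ hk
      exact mul_le_of_le_one_left (norm_nonneg _) (inv_le_one_of_one_le₀ (one_le_pow₀ hz1'))
    have h := hu.smul (Units.mk0 _ hw)
    rw [Units.smul_def, Units.val_mk0, smul_sub, smul_smul, mul_inv_cancel₀ hw, one_smul] at h
    change IsUnit _
    rwa [Algebra.algebraMap_eq_smul_one]

theorem IsSchurStable.transpose {n : ℕ} (hn : 0 < n) {M : Matrix (Fin n) (Fin n) ℝ}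
    (hM : IsSchurStable M) : IsSchurStable Mᵀ := by
  rw [isSchurStable_iff_exists_norm_pow_lt_one hn] at hM ⊢
  simpa only [← transpose_pow, frobenius_norm_transpose] using hM

theorem isOpen_setOf_isSchurStable {n : ℕ} (hn : 0 < n) :
    IsOpen {M : Matrix (Fin n) (Fin n) ℝ | IsSchurStable M} := by
  simp only [isSchurStable_iff_exists_norm_pow_lt_one hn, Set.ofPred_exists]
  exact isOpen_iUnion fun k => isOpen_lt ((continuous_pow (k + 1)).norm) continuous_const

/-! ### The discrete Lyapunov equation -/

/-- The solution `∑ₜ (Mᵗ)ᵀ C Mᵗ` of the discrete Lyapunov equation `Mᵀ P M + C = P`. -/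
noncomputable def lyapunovSol {n : ℕ} (M C : Matrix (Fin n) (Fin n) ℝ) :
    Matrix (Fin n) (Fin n) ℝ :=
  ∑' t : ℕ, (M ^ t)ᵀ * C * M ^ t

namespace IsSchurStable

variable {n : ℕ} {M : Matrix (Fin n) (Fin n) ℝ}

theorem hasSum_lyapunovSol (hM : IsSchurStable M) (C : Matrix (Fin n) (Fin n) ℝ) :
    HasSum (fun t : ℕ => (M ^ t)ᵀ * C * M ^ t) (lyapunovSol M C) := by
  have : CompleteSpace (Matrix (Fin n) (Fin n) ℝ) := FiniteDimensional.complete ℝ _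
  obtain ⟨r, hr0, hr1, h⟩ := hM.exists_eventually_norm_pow_le
  refine Summable.hasSum (Summable.of_norm_bounded_eventually_nat
    (g := fun t => ‖C‖ * r ^ t) ((summable_geometric_of_lt_one hr0 hr1).mul_left _) ?_)
  filter_upwards [h] with t ht
  calc ‖(M ^ t)ᵀ * C * M ^ t‖ ≤ ‖(M ^ t)ᵀ * C‖ * ‖M ^ t‖ := frobenius_norm_mul _ _
    _ ≤ (‖(M ^ t)ᵀ‖ * ‖C‖) * ‖M ^ t‖ := by gcongr; exact frobenius_norm_mul _ _
    _ ≤ (r ^ t * ‖C‖) * r ^ t := by rw [frobenius_norm_transpose]; gcongr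
    _ = ‖C‖ * r ^ t * r ^ t := by ring
    _ ≤ ‖C‖ * r ^ t := mul_le_of_le_one_right (by positivity) (pow_le_one₀ hr0 hr1.le)

theorem lyapunovSol_eq (hM : IsSchurStable M) (C : Matrix (Fin n) (Fin n) ℝ) :
    Mᵀ * lyapunovSol M C * M + C = lyapunovSol M C := by
  have h1 := ((hM.hasSum_lyapunovSol C).mul_left Mᵀ).mul_right M
  have h2 := (hasSum_nat_add_iff (f := fun t : ℕ => (M ^ t)ᵀ * C * M ^ t) 1).1
    (h1.congr_fun fun t => by simp [pow_succ, Matrix.mul_assoc])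
  simpa using h2.unique (hM.hasSum_lyapunovSol C)

/-- The homogeneous Lyapunov equation has only the trivial solution: iterating it gives
`D = (Mᵗ)ᵀ D Mᵗ`, which tends to `0`. -/
theorem eq_zero_of_transpose_mul_mul_eq (hM : IsSchurStable M) {D : Matrix (Fin n) (Fin n) ℝ}
    (hD : Mᵀ * D * M = D) : D = 0 := by
  have h : ∀ t : ℕ, (M ^ t)ᵀ * D * M ^ t = D := by
    intro t
    induction t with
    | zero => simp
    | succ t ih =>
      rw [pow_succ', transpose_mul]
      calc (M ^ t)ᵀ * Mᵀ * D * (M * M ^ t) = (M ^ t)ᵀ * (Mᵀ * D * M) * M ^ t := by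
            simp only [Matrix.mul_assoc]
        _ = D := by rw [hD, ih]
  have h0 := (hM.hasSum_lyapunovSol D).summable.tendsto_atTop_zero
  simp only [h] at h0
  exact tendsto_nhds_unique tendsto_const_nhds h0

theorem eq_lyapunovSol (hM : IsSchurStable M) {C P : Matrix (Fin n) (Fin n) ℝ}
    (hP : Mᵀ * P * M + C = P) : P = lyapunovSol M C := by
  have hL := hM.lyapunovSol_eq C
  refine sub_eq_zero.1 (hM.eq_zero_of_transpose_mul_mul_eq ?_)
  rw [Matrix.mul_sub, Matrix.sub_mul]
  conv_rhs => rw [← hP, ← hL]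
  abel

/-- The solution operators of the Lyapunov equations of `M` and `Mᵀ` are adjoint to each other for
the trace pairing. -/
theorem trace_lyapunovSol_mul (hn : 0 < n) (hM : IsSchurStable M)
    (C D : Matrix (Fin n) (Fin n) ℝ) :
    (lyapunovSol M C * D).trace = (C * lyapunovSol Mᵀ D).trace := by
  have hL := hM.lyapunovSol_eq C
  have hS := (hM.transpose hn).lyapunovSol_eq D
  set P := lyapunovSol M C
  set X := lyapunovSol Mᵀ D
  rw [transpose_transpose] at hS
  have h : (P * (M * X * Mᵀ)).trace = (Mᵀ * P * M * X).trace := by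
    rw [← Matrix.mul_assoc, trace_mul_comm]
    simp only [Matrix.mul_assoc]
  have e1 : (P * D).trace = (P * X).trace - (P * (M * X * Mᵀ)).trace := by
    rw [← trace_sub, ← Matrix.mul_sub]; congr 2; nth_rewrite 1 [← hS]; abel
  have e2 : (C * X).trace = (P * X).trace - (Mᵀ * P * M * X).trace := by
    rw [← trace_sub, ← Matrix.sub_mul]; congr 2; nth_rewrite 1 [← hL]; abel
  rw [e1, e2, h]

theorem hasSum_quadraticForm (hM : IsSchurStable M) (C : Matrix (Fin n) (Fin n) ℝ)
    (x : Fin n → ℝ) :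
    HasSum (fun t : ℕ => (M ^ t *ᵥ x) ⬝ᵥ (C *ᵥ (M ^ t *ᵥ x))) (x ⬝ᵥ (lyapunovSol M C *ᵥ x)) := by
  have hc : Continuous fun X : Matrix (Fin n) (Fin n) ℝ => x ⬝ᵥ (X *ᵥ x) := by fun_prop
  have h := (hM.hasSum_lyapunovSol C).map
    (AddMonoidHom.mk' (fun X : Matrix (Fin n) (Fin n) ℝ => x ⬝ᵥ (X *ᵥ x))
      fun X Y => by rw [add_mulVec, dotProduct_add]) hc
  refine h.congr_fun fun t => ?_
  simp only [Function.comp_apply, AddMonoidHom.mk'_apply, ← mulVec_mulVec]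
  rw [dotProduct_mulVec x, vecMul_transpose]

theorem isHermitian_lyapunovSol (hM : IsSchurStable M) {C : Matrix (Fin n) (Fin n) ℝ}
    (hC : C.IsHermitian) : (lyapunovSol M C).IsHermitian := by
  have hC' : Cᵀ = C := by simpa using hC.eq
  have h : (lyapunovSol M C)ᵀ = lyapunovSol M C := by
    refine hM.eq_lyapunovSol ?_
    have h := congrArg Matrix.transpose (hM.lyapunovSol_eq C)
    simpa [transpose_mul, hC', Matrix.mul_assoc] using h
  simpa [IsHermitian] using h

theorem posSemidef_lyapunovSol_sub (hM : IsSchurStable M) {C : Matrix (Fin n) (Fin n) ℝ}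
    (hC : C.PosSemidef) : (lyapunovSol M C - C).PosSemidef := by
  refine .of_dotProduct_mulVec_nonneg
    ((hM.isHermitian_lyapunovSol hC.isHermitian).sub hC.isHermitian) fun x => ?_
  have h := (hM.hasSum_quadraticForm C x).summable.le_tsum 0
    fun t _ => by simpa using hC.dotProduct_mulVec_nonneg (M ^ t *ᵥ x)
  rw [(hM.hasSum_quadraticForm C x).tsum_eq] at h
  simp only [pow_zero, one_mulVec] at h
  simp only [star_trivial, sub_mulVec, dotProduct_sub]
  linarith

theorem posSemidef_lyapunovSol (hM : IsSchurStable M) {C : Matrix (Fin n) (Fin n) ℝ}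
    (hC : C.PosSemidef) : (lyapunovSol M C).PosSemidef := by
  simpa using (hM.posSemidef_lyapunovSol_sub hC).add hC

end IsSchurStable

/-! ### Analytic dependence of the Lyapunov solution -/

section Analytic

variable {X : Type*} [NormedAddCommGroup X] [NormedSpace ℝ X]

theorem AnalyticAt.matrix_mul {p q r : ℕ} {f : X → Matrix (Fin p) (Fin q) ℝ}
    {g : X → Matrix (Fin q) (Fin r) ℝ} {x : X} (hf : AnalyticAt ℝ f x) (hg : AnalyticAt ℝ g x) :
    AnalyticAt ℝ (fun y => f y * g y) x := by
  let b : Matrix (Fin p) (Fin q) ℝ →L[ℝ] Matrix (Fin q) (Fin r) ℝ →L[ℝ] Matrix (Fin p) (Fin r) ℝ :=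
    LinearMap.mkContinuous₂ (LinearMap.mk₂ ℝ (fun M N => M * N) (fun _ _ _ => Matrix.add_mul _ _ _)
      (fun _ _ _ => Matrix.smul_mul _ _ _) (fun _ _ _ => Matrix.mul_add _ _ _)
      (fun _ _ _ => Matrix.mul_smul _ _ _)) 1
      (fun M N => by simpa using frobenius_norm_mul M N)
  exact (b.analyticAt_bilinear (f x, g x)).comp₂ hf hg

theorem AnalyticAt.linearMap_comp {Y Z : Type*} [NormedAddCommGroup Y] [NormedSpace ℝ Y]
    [FiniteDimensional ℝ Y] [NormedAddCommGroup Z] [NormedSpace ℝ Z] (l : Y →ₗ[ℝ] Z) {f : X → Y}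
    {x : X} (hf : AnalyticAt ℝ f x) : AnalyticAt ℝ (fun y => l (f y)) x :=
  (l.toContinuousLinearMap.analyticAt (f x)).comp hf

theorem AnalyticAt.matrix_transpose {p q : ℕ} {f : X → Matrix (Fin p) (Fin q) ℝ} {x : X}
    (hf : AnalyticAt ℝ f x) : AnalyticAt ℝ (fun y => (f y)ᵀ) x :=
  hf.linearMap_comp (transposeLinearEquiv (Fin p) (Fin q) ℝ ℝ).toLinearMap

theorem AnalyticAt.matrix_trace {p : ℕ} {f : X → Matrix (Fin p) (Fin p) ℝ} {x : X}
    (hf : AnalyticAt ℝ f x) : AnalyticAt ℝ (fun y => (f y).trace) x :=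
  hf.linearMap_comp (traceLinearMap (Fin p) ℝ ℝ)

/-- In a Banach algebra, the solution `P` of the linear equation `P - a P b = c` depends analytically
on the data as long as the equation is uniquely solvable, because inversion of bounded operators is
analytic. -/
theorem AnalyticAt.of_sub_mul_mul_eq {𝔸 : Type*} [NormedRing 𝔸] [NormedAlgebra ℝ 𝔸]
    [CompleteSpace 𝔸] {F a b c : X → 𝔸} {x : X} (ha : AnalyticAt ℝ a x) (hb : AnalyticAt ℝ b x)
    (hc : AnalyticAt ℝ c x) (hbij : Function.Bijective fun P : 𝔸 => P - a x * P * b x)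
    (hF : ∀ᶠ y in 𝓝 x, F y - a y * F y * b y = c y) : AnalyticAt ℝ F x := by
  set op : X → 𝔸 →L[ℝ] 𝔸 := fun y => 1 - ContinuousLinearMap.mulLeftRight ℝ 𝔸 (a y) (b y) with hop
  have hop_apply : ∀ y P, op y P = P - a y * P * b y := fun y P => by simp [hop]
  have hunit : IsUnit (op x) := by
    rw [ContinuousLinearMap.isUnit_iff_bijective]
    simpa only [← hop_apply] using hbij
  have hop_an : AnalyticAt ℝ op x := analyticAt_const.sub
    (((ContinuousLinearMap.mulLeftRight ℝ 𝔸).analyticAt_bilinear (a x, b x)).comp₂ ha hb)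
  have hinv : AnalyticAt ℝ (fun y => Ring.inverse (op y)) x :=
    AnalyticAt.comp (g := Ring.inverse) (analyticAt_inverse hunit.unit) hop_an
  have happ : AnalyticAt ℝ (fun y => Ring.inverse (op y) (c y)) x :=
    ((ContinuousLinearMap.id ℝ (𝔸 →L[ℝ] 𝔸)).analyticAt_bilinear (_, c x)).comp₂ hinv hc
  refine happ.congr ?_
  filter_upwards [hF, hop_an.continuousAt.eventually (Units.isOpen.mem_nhds hunit)] with y hy hu
  rw [← hy, ← hop_apply]
  exact DFunLike.congr_fun (Ring.inverse_mul_cancel _ hu) (F y)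

theorem AnalyticAt.lyapunovSol {n : ℕ} (hn : 0 < n) {f g : X → Matrix (Fin n) (Fin n) ℝ} {x : X}
    (hf : AnalyticAt ℝ f x) (hg : AnalyticAt ℝ g x) (hM : IsSchurStable (f x)) :
    AnalyticAt ℝ (fun y => lyapunovSol (f y) (g y)) x := by
  have : CompleteSpace (Matrix (Fin n) (Fin n) ℝ) := FiniteDimensional.complete ℝ _
  refine AnalyticAt.of_sub_mul_mul_eq hf.matrix_transpose hf hg ⟨fun P P' h => ?_, fun C =>
    ⟨_root_.lyapunovSol (f x) C, sub_eq_iff_eq_add'.2 (hM.lyapunovSol_eq C).symm⟩⟩ ?_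
  · refine sub_eq_zero.1 (hM.eq_zero_of_transpose_mul_mul_eq ?_)
    rw [Matrix.mul_sub, Matrix.sub_mul]
    exact (sub_eq_sub_iff_sub_eq_sub.1 h).symm
  · filter_upwards [hf.continuousAt.eventually ((isOpen_setOf_isSchurStable hn).mem_nhds hM)]
      with y hy
    exact sub_eq_iff_eq_add'.2 (IsSchurStable.lyapunovSol_eq hy _).symm

end Analytic

/-! ### The cost and the state correlation as solutions of Lyapunov equations -/

namespace LQRProblem

variable {n m : ℕ} (S : LQRProblem n m)

/-- The closed-loop matrix `A - BK`. -/
def closedLoop (K : Matrix (Fin m) (Fin n) ℝ) : Matrix (Fin n) (Fin n) ℝ := S.A - S.B * K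

/-- The weight `Q + Kᵀ R K` of the state in the stage cost under the feedback `u = -K x`. -/
def weight (K : Matrix (Fin m) (Fin n) ℝ) : Matrix (Fin n) (Fin n) ℝ := S.Q + Kᵀ * S.R * K

/-- The matrix `P_K`, solution of the Lyapunov equation of the gain `K`. -/
noncomputable def valueMatrix (K : Matrix (Fin m) (Fin n) ℝ) : Matrix (Fin n) (Fin n) ℝ :=
  lyapunovSol (S.closedLoop K) (S.weight K)

variable {S} {K : Matrix (Fin m) (Fin n) ℝ}

theorem isSchurStable_closedLoop (hK : K ∈ S.stabilizing) : IsSchurStable (S.closedLoop K) := hK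

theorem state_eq (K : Matrix (Fin m) (Fin n) ℝ) (x₀ : Fin n → ℝ) (t : ℕ) :
    S.state K x₀ t = S.closedLoop K ^ t *ᵥ x₀ := by
  induction t with
  | zero => simp [state]
  | succ t ih =>
    rw [state, ih, pow_succ', ← mulVec_mulVec, closedLoop, sub_mulVec, mulVec_neg,
      mulVec_mulVec _ S.B]
    abel

theorem stageCost_eq (K : Matrix (Fin m) (Fin n) ℝ) (x₀ : Fin n → ℝ) (t : ℕ) :
    S.stageCost K x₀ t
      = (S.closedLoop K ^ t *ᵥ x₀) ⬝ᵥ (S.weight K *ᵥ (S.closedLoop K ^ t *ᵥ x₀)) := by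
  rw [stageCost, input, state_eq]
  set x := S.closedLoop K ^ t *ᵥ x₀
  rw [weight, add_mulVec, dotProduct_add, mulVec_neg, neg_dotProduct_neg, ← mulVec_mulVec,
    ← mulVec_mulVec, dotProduct_mulVec x Kᵀ, vecMul_transpose]

theorem isLyapunovSolution_iff (hK : K ∈ S.stabilizing) (P : Matrix (Fin n) (Fin n) ℝ) :
    S.IsLyapunovSolution K P ↔ P = S.valueMatrix K := by
  have hM := isSchurStable_closedLoop hK
  unfold IsLyapunovSolution
  rw [add_assoc]
  refine ⟨fun h => hM.eq_lyapunovSol h, ?_⟩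
  rintro rfl
  exact hM.lyapunovSol_eq _

theorem hasSum_stageCost (hK : K ∈ S.stabilizing) (x₀ : Fin n → ℝ) :
    HasSum (S.stageCost K x₀) (x₀ ⬝ᵥ (S.valueMatrix K *ᵥ x₀)) :=
  ((isSchurStable_closedLoop hK).hasSum_quadraticForm (S.weight K) x₀).congr_fun
    fun t => stageCost_eq K x₀ t

theorem integrable_mul_coord (hmom : ∀ i, MemLp (fun x₀ : Fin n → ℝ => x₀ i) 2 S.law)
    (i j : Fin n) : Integrable (fun x₀ : Fin n → ℝ => x₀ i * x₀ j) S.law :=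
  (hmom i).integrable_mul (hmom j)

theorem dotProduct_mulVec_eq_sum (C : Matrix (Fin n) (Fin n) ℝ) (x : Fin n → ℝ) :
    x ⬝ᵥ (C *ᵥ x) = ∑ i, ∑ j, C i j * (x j * x i) := by
  simp only [dotProduct, mulVec, Finset.mul_sum]
  exact Finset.sum_congr rfl fun i _ => Finset.sum_congr rfl fun j _ => by ring

theorem integrable_quadraticForm (hmom : ∀ i, MemLp (fun x₀ : Fin n → ℝ => x₀ i) 2 S.law)
    (C : Matrix (Fin n) (Fin n) ℝ) :
    Integrable (fun x₀ : Fin n → ℝ => x₀ ⬝ᵥ (C *ᵥ x₀)) S.law := by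
  simp only [dotProduct_mulVec_eq_sum]
  exact integrable_finsetSum _ fun i _ => integrable_finsetSum _ fun j _ =>
    (integrable_mul_coord hmom j i).const_mul _

theorem integral_quadraticForm (hmom : ∀ i, MemLp (fun x₀ : Fin n → ℝ => x₀ i) 2 S.law)
    (C : Matrix (Fin n) (Fin n) ℝ) :
    ∫ x₀, x₀ ⬝ᵥ (C *ᵥ x₀) ∂S.law = (C * S.Sigma0).trace := by
  simp only [dotProduct_mulVec_eq_sum]
  have hint := fun i j => (integrable_mul_coord hmom j i).const_mul (C i j)
  rw [integral_finsetSum _ fun i _ => integrable_finsetSum _ fun j _ => hint i j]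
  simp only [trace, diag_apply, mul_apply]
  refine Finset.sum_congr rfl fun i _ => ?_
  rw [integral_finsetSum _ fun j _ => hint i j]
  exact Finset.sum_congr rfl fun j _ => by rw [integral_const_mul]; rfl

theorem cost_eq_trace_valueMatrix (hmom : ∀ i, MemLp (fun x₀ : Fin n → ℝ => x₀ i) 2 S.law)
    (hK : K ∈ S.stabilizing) : S.cost K = (S.valueMatrix K * S.Sigma0).trace := by
  rw [← integral_quadraticForm hmom, cost]
  simp only [(hasSum_stageCost hK _).tsum_eq]

/-- The state correlation solves the dual Lyapunov equation `M X Mᵀ + Σ₀ = X`. Entrywise, it is the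
expectation of a quadratic form of `x₀`, and the adjointness of the two Lyapunov equations moves the
solution operator onto `Σ₀`. -/
theorem SigmaK_eq_lyapunovSol (hn : 0 < n)
    (hmom : ∀ i, MemLp (fun x₀ : Fin n → ℝ => x₀ i) 2 S.law) (hcov : S.Sigma0.PosDef)
    (hK : K ∈ S.stabilizing) :
    S.SigmaK K = lyapunovSol (S.closedLoop K)ᵀ S.Sigma0 := by
  have hM := isSchurStable_closedLoop hK
  have hsymm := (hM.transpose hn).isHermitian_lyapunovSol hcov.isHermitian
  ext i j
  have h : ∀ x₀ : Fin n → ℝ, ∑' t, S.state K x₀ t i * S.state K x₀ t j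
      = x₀ ⬝ᵥ (lyapunovSol (S.closedLoop K) (single i j 1) *ᵥ x₀) := by
    intro x₀
    rw [← (hM.hasSum_quadraticForm (single i j 1) x₀).tsum_eq]
    refine tsum_congr fun t => ?_
    have e : ∀ x : Fin n → ℝ, x ⬝ᵥ (single i j (1 : ℝ) *ᵥ x) = x i * x j := fun x => by
      rw [dotProduct_mulVec_eq_sum]
      simp [single_apply, ite_and, mul_comm]
    rw [state_eq, e]
  simp only [SigmaK, of_apply, h]
  rw [integral_quadraticForm hmom, hM.trace_lyapunovSol_mul hn, trace_single_mul]
  simpa using hsymm.apply i j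

/-! ### Analyticity of the cost -/

theorem analyticAt_closedLoop (K : Matrix (Fin m) (Fin n) ℝ) : AnalyticAt ℝ S.closedLoop K :=
  analyticAt_const.sub (analyticAt_const.matrix_mul analyticAt_id)

theorem analyticAt_weight (K : Matrix (Fin m) (Fin n) ℝ) : AnalyticAt ℝ S.weight K :=
  analyticAt_const.add
    ((analyticAt_id.matrix_transpose.matrix_mul analyticAt_const).matrix_mul analyticAt_id)

theorem isOpen_stabilizing (hn : 0 < n) : IsOpen S.stabilizing :=
  (isOpen_setOf_isSchurStable hn).preimage
    (continuous_iff_continuousAt.2 fun K => (analyticAt_closedLoop (S := S) K).continuousAt)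

theorem analyticOnNhd_cost (hn : 0 < n)
    (hmom : ∀ i, MemLp (fun x₀ : Fin n → ℝ => x₀ i) 2 S.law) :
    AnalyticOnNhd ℝ S.cost S.stabilizing := by
  intro K hK
  have h : AnalyticAt ℝ (fun K => (S.valueMatrix K * S.Sigma0).trace) K :=
    (((analyticAt_closedLoop K).lyapunovSol hn (analyticAt_weight K)
      (isSchurStable_closedLoop hK)).matrix_mul analyticAt_const).matrix_trace
  refine h.congr ?_
  filter_upwards [(isOpen_stabilizing hn).mem_nhds hK] with K' hK'
  exact (cost_eq_trace_valueMatrix hmom hK').symm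

theorem continuousAt_SigmaK (hn : 0 < n)
    (hmom : ∀ i, MemLp (fun x₀ : Fin n → ℝ => x₀ i) 2 S.law) (hcov : S.Sigma0.PosDef)
    (hK : K ∈ S.stabilizing) : ContinuousAt S.SigmaK K := by
  have h : AnalyticAt ℝ (fun K => lyapunovSol (S.closedLoop K)ᵀ S.Sigma0) K :=
    (analyticAt_closedLoop K).matrix_transpose.lyapunovSol hn analyticAt_const
      ((isSchurStable_closedLoop hK).transpose hn)
  refine h.continuousAt.congr ?_
  filter_upwards [(isOpen_stabilizing hn).mem_nhds hK] with K' hK'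
  exact (SigmaK_eq_lyapunovSol hn hmom hcov hK').symm

/-! ### Lower bounds and coercivity -/

theorem posSemidef_SigmaK_sub (hn : 0 < n)
    (hmom : ∀ i, MemLp (fun x₀ : Fin n → ℝ => x₀ i) 2 S.law) (hcov : S.Sigma0.PosDef)
    (hK : K ∈ S.stabilizing) :
    (S.SigmaK K - sigmaMin S.Sigma0 • (1 : Matrix (Fin n) (Fin n) ℝ)).PosSemidef := by
  have h := ((isSchurStable_closedLoop hK).transpose hn).posSemidef_lyapunovSol_sub hcov.posSemidef
  rw [← SigmaK_eq_lyapunovSol hn hmom hcov hK] at h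
  simpa using h.add hcov.posSemidef_sub_sigmaMin

theorem posDef_SigmaK (hn : 0 < n)
    (hmom : ∀ i, MemLp (fun x₀ : Fin n → ℝ => x₀ i) 2 S.law) (hcov : S.Sigma0.PosDef)
    (hK : K ∈ S.stabilizing) : (S.SigmaK K).PosDef := by
  have h := ((isSchurStable_closedLoop hK).transpose hn).posSemidef_lyapunovSol_sub hcov.posSemidef
  rw [← SigmaK_eq_lyapunovSol hn hmom hcov hK] at h
  simpa using hcov.add_posSemidef h

theorem posSemidef_weight_sub_sigmaMin_Q (hQ : S.Q.PosDef) (hR : S.R.PosDef)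
    (K : Matrix (Fin m) (Fin n) ℝ) :
    (S.weight K - sigmaMin S.Q • (1 : Matrix (Fin n) (Fin n) ℝ)).PosSemidef := by
  have h := hQ.posSemidef_sub_sigmaMin.add (hR.posSemidef.transpose_mul_mul K)
  rwa [sub_add_eq_add_sub] at h

theorem posSemidef_weight_sub_sigmaMin_R (hQ : S.Q.PosDef) (hR : S.R.PosDef)
    (K : Matrix (Fin m) (Fin n) ℝ) :
    (S.weight K - sigmaMin S.R • (Kᵀ * K)).PosSemidef := by
  have h := hQ.posSemidef.add (hR.posSemidef_sub_sigmaMin.transpose_mul_mul K)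
  simpa [weight, Matrix.mul_sub, Matrix.sub_mul, add_sub_assoc] using h

theorem cost_eq_trace_weight (hn : 0 < n)
    (hmom : ∀ i, MemLp (fun x₀ : Fin n → ℝ => x₀ i) 2 S.law) (hcov : S.Sigma0.PosDef)
    (hK : K ∈ S.stabilizing) : S.cost K = (S.weight K * S.SigmaK K).trace := by
  rw [cost_eq_trace_valueMatrix hmom hK, valueMatrix,
    (isSchurStable_closedLoop hK).trace_lyapunovSol_mul hn, SigmaK_eq_lyapunovSol hn hmom hcov hK]

theorem norm_sq_le_trace_transpose_mul_self_mul_SigmaK (hn : 0 < n)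
    (hmom : ∀ i, MemLp (fun x₀ : Fin n → ℝ => x₀ i) 2 S.law) (hcov : S.Sigma0.PosDef)
    (hK : K ∈ S.stabilizing) (N : Matrix (Fin m) (Fin n) ℝ) :
    sigmaMin S.Sigma0 * ‖N‖ ^ 2 ≤ (Nᵀ * N * S.SigmaK K).trace := by
  have h := (posSemidef_SigmaK_sub hn hmom hcov hK).trace_mul_le_trace_mul
    (posSemidef_transpose_mul_self N)
  rwa [Matrix.smul_mul, Matrix.one_mul, trace_smul, ← frobenius_norm_sq, smul_eq_mul,
    trace_mul_comm] at h

theorem mul_norm_sq_le_cost (hn : 0 < n) (hm : 0 < m) (hQ : S.Q.PosDef) (hR : S.R.PosDef)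
    (hmom : ∀ i, MemLp (fun x₀ : Fin n → ℝ => x₀ i) 2 S.law) (hcov : S.Sigma0.PosDef)
    (hK : K ∈ S.stabilizing) :
    sigmaMin S.R * sigmaMin S.Sigma0 * ‖K‖ ^ 2 ≤ S.cost K := by
  have h1 := (posSemidef_weight_sub_sigmaMin_R hQ hR K).trace_mul_le_trace_mul
    (posDef_SigmaK hn hmom hcov hK).posSemidef
  rw [← cost_eq_trace_weight hn hmom hcov hK, Matrix.smul_mul, trace_smul, smul_eq_mul] at h1
  have h2 := mul_le_mul_of_nonneg_left
    (norm_sq_le_trace_transpose_mul_self_mul_SigmaK hn hmom hcov hK K) (hR.sigmaMin_pos hm).le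
  rw [mul_assoc]
  exact h2.trans h1

/-- The cost dominates the partial sums of the squared Frobenius norms of the powers of the
closed-loop matrix; these partial sums are large near the boundary of the set of stabilizing gains. -/
theorem mul_sum_norm_pow_sq_le_cost (hn : 0 < n) (hQ : S.Q.PosDef) (hR : S.R.PosDef)
    (hmom : ∀ i, MemLp (fun x₀ : Fin n → ℝ => x₀ i) 2 S.law) (hcov : S.Sigma0.PosDef)
    (hK : K ∈ S.stabilizing) (s : Finset ℕ) :
    sigmaMin S.Sigma0 * (sigmaMin S.Q * ∑ t ∈ s, ‖S.closedLoop K ^ t‖ ^ 2) ≤ S.cost K := by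
  have hM := isSchurStable_closedLoop hK
  have hW := posSemidef_weight_sub_sigmaMin_Q hQ hR K
  have hWpos : (S.weight K).PosSemidef := hQ.posSemidef.add (hR.posSemidef.transpose_mul_mul K)
  have hP : (S.valueMatrix K).PosSemidef := hM.posSemidef_lyapunovSol hWpos
  have h1 := hcov.posSemidef_sub_sigmaMin.trace_mul_le_trace_mul hP
  rw [trace_mul_comm S.Sigma0, ← cost_eq_trace_valueMatrix hmom hK, Matrix.smul_mul,
    Matrix.one_mul, trace_smul, smul_eq_mul] at h1
  refine le_trans (mul_le_mul_of_nonneg_left ?_ (hcov.sigmaMin_pos hn).le) h1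
  have hsum := (hM.hasSum_lyapunovSol (S.weight K)).map (traceAddMonoidHom (Fin n) ℝ)
    (by exact continuous_id.matrix_trace)
  refine le_trans ?_ (sum_le_hasSum s (fun t _ => ?_) hsum)
  · rw [Finset.mul_sum]
    refine Finset.sum_le_sum fun t _ => ?_
    have h2 := (hW.transpose_mul_mul (S.closedLoop K ^ t)).trace_nonneg
    rw [Matrix.mul_sub, Matrix.sub_mul, trace_sub, Matrix.mul_smul, Matrix.smul_mul, trace_smul,
      Matrix.mul_one, ← frobenius_norm_sq, smul_eq_mul] at h2
    exact sub_nonneg.1 h2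
  · exact (hWpos.transpose_mul_mul (S.closedLoop K ^ t)).trace_nonneg

theorem isCoerciveOn_cost (hn : 0 < n) (hm : 0 < m) (hQ : S.Q.PosDef) (hR : S.R.PosDef)
    (hmom : ∀ i, MemLp (fun x₀ : Fin n → ℝ => x₀ i) 2 S.law) (hcov : S.Sigma0.PosDef) :
    IsCoerciveOn S.cost S.stabilizing := by
  have hs := hcov.sigmaMin_pos hn
  have hr := hR.sigmaMin_pos hm
  have hq := hQ.sigmaMin_pos hn
  rintro K hK (hinf | ⟨Kb, hKb, hlim⟩)
  · refine tendsto_atTop_mono (fun l => mul_norm_sq_le_cost hn hm hQ hR hmom hcov (hK l)) ?_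
    exact ((tendsto_pow_atTop two_ne_zero).comp
      (tendsto_atTop_mono (fun l => sigmaMax_le_norm (K l)) hinf)).const_mul_atTop (mul_pos hr hs)
  · have hKb' : Kb ∉ S.stabilizing := by
      rw [frontier, (isOpen_stabilizing hn).interior_eq] at hKb
      exact hKb.2
    have hpow : ∀ k, 1 ≤ ‖S.closedLoop Kb ^ (k + 1)‖ := by
      intro k
      by_contra hlt
      exact hKb' ((isSchurStable_iff_exists_norm_pow_lt_one hn).2 ⟨k, not_le.1 hlt⟩)
    refine tendsto_atTop.2 fun c => ?_
    obtain ⟨T, hT⟩ := exists_nat_gt (c / (sigmaMin S.Sigma0 * sigmaMin S.Q))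
    set g : Matrix (Fin m) (Fin n) ℝ → ℝ := fun K =>
      sigmaMin S.Sigma0 * (sigmaMin S.Q * ∑ t ∈ Finset.Ico 1 (T + 1), ‖S.closedLoop K ^ t‖ ^ 2)
      with hg
    have hgc : ContinuousAt g Kb := by
      have := (analyticAt_closedLoop (S := S) Kb).continuousAt
      fun_prop
    have hgb : c < g Kb := by
      rw [div_lt_iff₀ (mul_pos hs hq)] at hT
      have h1 : (T : ℝ) ≤ ∑ t ∈ Finset.Ico 1 (T + 1), ‖S.closedLoop Kb ^ t‖ ^ 2 := by
        have := Finset.card_nsmul_le_sum (Finset.Ico 1 (T + 1))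
          (fun t => ‖S.closedLoop Kb ^ t‖ ^ 2) 1 fun t ht => by
            obtain ⟨k, rfl⟩ : ∃ k, t = k + 1 := ⟨t - 1, by grind⟩
            exact one_le_pow₀ (hpow k)
        simpa using this
      calc c < T * (sigmaMin S.Sigma0 * sigmaMin S.Q) := hT
        _ = sigmaMin S.Sigma0 * (sigmaMin S.Q * T) := by ring
        _ ≤ g Kb := by simp only [hg]; gcongr
    filter_upwards [(hgc.tendsto.comp hlim).eventually (lt_mem_nhds hgb)] with l hl
    exact hl.le.trans (mul_sum_norm_pow_sq_le_cost hn hQ hR hmom hcov (hK l) _)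

/-! ### Compact sublevel sets and existence of an optimal gain -/

theorem isCompact_sublevelSet_cost (hn : 0 < n) (hm : 0 < m) (hQ : S.Q.PosDef) (hR : S.R.PosDef)
    (hmom : ∀ i, MemLp (fun x₀ : Fin n → ℝ => x₀ i) 2 S.law) (hcov : S.Sigma0.PosDef) (c : ℝ) :
    IsCompact (sublevelSet S.cost S.stabilizing c) := by
  have hrs := mul_pos (hR.sigmaMin_pos hm) (hcov.sigmaMin_pos hn)
  have : ProperSpace (Matrix (Fin m) (Fin n) ℝ) := FiniteDimensional.proper ℝ _
  refine Metric.isCompact_of_isClosed_isBounded (isClosed_of_closure_subset fun Kb hKb => ?_) ?_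
  · obtain ⟨K, hK, hlim⟩ := mem_closure_iff_seq_limit.1 hKb
    have hmem : Kb ∈ S.stabilizing := by
      by_contra hnot
      have hfr : Kb ∈ frontier S.stabilizing := by
        rw [frontier, (isOpen_stabilizing hn).interior_eq]
        exact ⟨mem_closure_of_tendsto hlim (Eventually.of_forall fun l => (hK l).1), hnot⟩
      have htop := isCoerciveOn_cost hn hm hQ hR hmom hcov K (fun l => (hK l).1)
        (Or.inr ⟨Kb, hfr, hlim⟩)
      obtain ⟨l, hl⟩ := (htop.eventually (eventually_gt_atTop c)).exists
      exact absurd (hK l).2 (not_le.2 hl)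
    exact ⟨hmem, le_of_tendsto (((analyticOnNhd_cost hn hmom) Kb hmem).continuousAt.tendsto.comp
      hlim) (Eventually.of_forall fun l => (hK l).2)⟩
  · refine isBounded_iff_forall_norm_le.2 ⟨√(c / (sigmaMin S.R * sigmaMin S.Sigma0)), ?_⟩
    intro K hK
    refine Real.le_sqrt_of_sq_le ?_
    rw [le_div_iff₀ hrs, mul_comm]
    exact (mul_norm_sq_le_cost hn hm hQ hR hmom hcov hK.1).trans hK.2

theorem exists_isOptimal_cost (hn : 0 < n) (hm : 0 < m) (hQ : S.Q.PosDef) (hR : S.R.PosDef)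
    (hmom : ∀ i, MemLp (fun x₀ : Fin n → ℝ => x₀ i) 2 S.law) (hcov : S.Sigma0.PosDef)
    (hne : S.stabilizing.Nonempty) : ∃ Kstar, IsOptimal S.cost S.stabilizing Kstar := by
  obtain ⟨K0, hK0⟩ := hne
  obtain ⟨Ks, hKs, hmin⟩ :=
    (isCompact_sublevelSet_cost hn hm hQ hR hmom hcov (S.cost K0)).exists_isMinOn ⟨K0, hK0, le_rfl⟩
      fun K hK => ((analyticOnNhd_cost hn hmom) K hK.1).continuousAt.continuousWithinAt
  refine ⟨Ks, hKs.1, fun K hK => ?_⟩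
  rcases le_total (S.cost K) (S.cost K0) with h | h
  · exact hmin ⟨hK, h⟩
  · exact hKs.2.trans h

end LQRProblem

/-! ### The gradient of the cost -/

theorem fderiv_apply_eq_trace_matrixGrad {m n : ℕ} (J : Matrix (Fin m) (Fin n) ℝ → ℝ)
    (K H : Matrix (Fin m) (Fin n) ℝ) : fderiv ℝ J K H = ((matrixGrad J K)ᵀ * H).trace := by
  rw [trace_transpose_mul_eq_sum]
  conv_lhs => rw [matrix_eq_sum_single H]
  simp only [map_sum]
  refine Finset.sum_congr rfl fun i _ => Finset.sum_congr rfl fun j _ => ?_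
  have h : single i j (H i j) = H i j • single i j (1 : ℝ) := by simp
  rw [h, map_smul, smul_eq_mul, mul_comm]
  rfl

theorem matrixGrad_eq_of_fderiv_apply {m n : ℕ} {J : Matrix (Fin m) (Fin n) ℝ → ℝ}
    {K G : Matrix (Fin m) (Fin n) ℝ} (h : ∀ H, fderiv ℝ J K H = (Hᵀ * G).trace) :
    matrixGrad J K = G := by
  ext i j
  rw [matrixGrad, of_apply, h, transpose_single, trace_single_mul]
  exact one_mul _

theorem trace_transpose_mul_mul_comm {m n : ℕ} {X : Matrix (Fin n) (Fin n) ℝ}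
    (hX : X.IsHermitian) (M N : Matrix (Fin m) (Fin n) ℝ) :
    (Mᵀ * N * X).trace = (Nᵀ * M * X).trace := by
  have hXt : Xᵀ = X := by simpa using hX.eq
  rw [← trace_transpose (Mᵀ * N * X), transpose_mul, transpose_mul, transpose_transpose, hXt,
    trace_mul_comm]

namespace LQRProblem

variable {n m : ℕ} {S : LQRProblem n m} {K K' : Matrix (Fin m) (Fin n) ℝ}

/-- The matrix `E_K = R K - Bᵀ P_K (A - B K)`; the gradient of the cost is `2 E_K Σ_K`. -/
noncomputable def gainResidual (S : LQRProblem n m) (K : Matrix (Fin m) (Fin n) ℝ) :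
    Matrix (Fin m) (Fin n) ℝ :=
  S.R * K - S.Bᵀ * S.valueMatrix K * S.closedLoop K

/-- The matrix `R + Bᵀ P_K B` of the quadratic term in the expansion of the cost around `K`. -/
noncomputable def gainCurvature (S : LQRProblem n m) (K : Matrix (Fin m) (Fin n) ℝ) :
    Matrix (Fin m) (Fin m) ℝ :=
  S.R + S.Bᵀ * S.valueMatrix K * S.B

theorem posSemidef_valueMatrix (hQ : S.Q.PosDef) (hR : S.R.PosDef) (hK : K ∈ S.stabilizing) :
    (S.valueMatrix K).PosSemidef :=
  (isSchurStable_closedLoop hK).posSemidef_lyapunovSol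
    (hQ.posSemidef.add (hR.posSemidef.transpose_mul_mul K))

theorem weight_add_sub_valueMatrix (hQ : S.Q.PosDef) (hR : S.R.PosDef) (hK : K ∈ S.stabilizing)
    (D : Matrix (Fin m) (Fin n) ℝ) :
    S.weight (K + D) + (S.closedLoop (K + D))ᵀ * S.valueMatrix K * S.closedLoop (K + D)
        - S.valueMatrix K
      = (S.gainResidual K)ᵀ * D + Dᵀ * S.gainResidual K + Dᵀ * S.gainCurvature K * D := by
  have hP : (S.closedLoop K)ᵀ * S.valueMatrix K * S.closedLoop K + S.weight K = S.valueMatrix K :=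
    (isSchurStable_closedLoop hK).lyapunovSol_eq _
  have hPt : (S.valueMatrix K)ᵀ = S.valueMatrix K := by
    simpa using (posSemidef_valueMatrix hQ hR hK).isHermitian.eq
  have hRt : S.Rᵀ = S.R := by simpa using hR.isHermitian.eq
  have hcl : S.closedLoop (K + D) = S.closedLoop K - S.B * D := by
    rw [closedLoop, closedLoop, Matrix.mul_add]; abel
  unfold gainResidual gainCurvature
  rw [hcl]
  set M := S.closedLoop K
  set P := S.valueMatrix K
  -- Only the isolated `P` is expanded by its Lyapunov equation.
  nth_rewrite 2 [← hP]
  simp only [weight, transpose_add, transpose_sub, transpose_mul, transpose_transpose, hPt, hRt,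
    Matrix.mul_add, Matrix.add_mul, Matrix.mul_sub, Matrix.sub_mul, Matrix.mul_assoc]
  abel

/-- The exact expansion of the cost around a stabilizing gain: the state correlation is the one of
the other gain, which makes the second-order expansion free of remainder. -/
theorem cost_sub_cost (hn : 0 < n) (hQ : S.Q.PosDef) (hR : S.R.PosDef)
    (hmom : ∀ i, MemLp (fun x₀ : Fin n → ℝ => x₀ i) 2 S.law) (hcov : S.Sigma0.PosDef)
    (hK : K ∈ S.stabilizing) (hK' : K' ∈ S.stabilizing) :
    S.cost K' - S.cost K = 2 * ((K' - K)ᵀ * S.gainResidual K * S.SigmaK K').trace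
      + ((K' - K)ᵀ * S.gainCurvature K * (K' - K) * S.SigmaK K').trace := by
  have hexp := weight_add_sub_valueMatrix hQ hR hK (K' - K)
  rw [add_sub_cancel] at hexp
  have hX := ((isSchurStable_closedLoop hK').transpose hn).lyapunovSol_eq S.Sigma0
  have hXs := (posDef_SigmaK hn hmom hcov hK').isHermitian
  rw [← SigmaK_eq_lyapunovSol hn hmom hcov hK', transpose_transpose] at hX
  rw [cost_eq_trace_weight hn hmom hcov hK', cost_eq_trace_valueMatrix hmom hK]
  set X := S.SigmaK K'
  set P := S.valueMatrix K
  set M := S.closedLoop K'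
  have h1 : (P * S.Sigma0).trace = (P * X).trace - (Mᵀ * P * M * X).trace := by
    have h2 : (P * (M * X * Mᵀ)).trace = (Mᵀ * P * M * X).trace := by
      rw [← Matrix.mul_assoc, trace_mul_comm]
      simp only [Matrix.mul_assoc]
    rw [← h2, ← trace_sub, ← Matrix.mul_sub]
    congr 2
    nth_rewrite 1 [← hX]
    abel
  have h3 := congrArg (fun Y => (Y * X).trace) hexp
  simp only [Matrix.add_mul, Matrix.sub_mul, trace_add, trace_sub] at h3
  have h4 := trace_transpose_mul_mul_comm hXs (S.gainResidual K) (K' - K)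
  simp only [Matrix.sub_mul, Matrix.mul_sub, transpose_sub, trace_sub] at h3 h4 ⊢
  linarith

/-- The directional derivative is read off the exact expansion, whose only implicit term is the state
correlation of the moving gain, which is continuous. -/
theorem fderiv_cost_apply (hn : 0 < n) (hQ : S.Q.PosDef) (hR : S.R.PosDef)
    (hmom : ∀ i, MemLp (fun x₀ : Fin n → ℝ => x₀ i) 2 S.law) (hcov : S.Sigma0.PosDef)
    (hK : K ∈ S.stabilizing) (H : Matrix (Fin m) (Fin n) ℝ) :
    fderiv ℝ S.cost K H = 2 * (Hᵀ * S.gainResidual K * S.SigmaK K).trace := by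
  have hd : DifferentiableAt ℝ S.cost K := ((analyticOnNhd_cost hn hmom) K hK).differentiableAt
  have h1 := (hasDerivAt_iff_tendsto_slope_zero.1 (hd.hasFDerivAt.hasLineDerivAt H))
  have hline : Tendsto (fun t : ℝ => K + t • H) (𝓝 0) (𝓝 K) := by
    have : ContinuousAt (fun t : ℝ => K + t • H) 0 := by fun_prop
    simpa [ContinuousAt] using this
  have hX : Tendsto (fun t : ℝ => S.SigmaK (K + t • H)) (𝓝[≠] 0) (𝓝 (S.SigmaK K)) :=
    ((continuousAt_SigmaK hn hmom hcov hK).tendsto.comp hline).mono_left nhdsWithin_le_nhds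
  have hc1 : Continuous fun X : ℝ × Matrix (Fin n) (Fin n) ℝ =>
      2 * (Hᵀ * S.gainResidual K * X.2).trace
        + X.1 * (Hᵀ * S.gainCurvature K * H * X.2).trace := by fun_prop
  have ht : Tendsto (fun t : ℝ => t) (𝓝[≠] 0) (𝓝 0) := nhdsWithin_le_nhds
  have h2 := (hc1.tendsto (0, S.SigmaK K)).comp (ht.prodMk_nhds hX)
  refine (tendsto_nhds_unique (h1.congr' ?_) (by simpa [Function.comp_def] using h2))
  filter_upwards [self_mem_nhdsWithin, nhdsWithin_le_nhds
    (hline.eventually ((isOpen_stabilizing hn).mem_nhds hK))] with t ht0 htS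
  have ht0' : t ≠ 0 := ht0
  have h := cost_sub_cost hn hQ hR hmom hcov hK htS
  rw [add_sub_cancel_left] at h
  simp only [zero_add, zero_smul, add_zero]
  rw [h]
  simp only [transpose_smul, Matrix.smul_mul, Matrix.mul_smul, trace_smul, smul_eq_mul]
  field_simp

theorem matrixGrad_cost (hn : 0 < n) (hQ : S.Q.PosDef) (hR : S.R.PosDef)
    (hmom : ∀ i, MemLp (fun x₀ : Fin n → ℝ => x₀ i) 2 S.law) (hcov : S.Sigma0.PosDef)
    (hK : K ∈ S.stabilizing) :
    matrixGrad S.cost K = (2 : ℝ) • (S.gainResidual K * S.SigmaK K) :=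
  matrixGrad_eq_of_fderiv_apply fun H => by
    rw [fderiv_cost_apply hn hQ hR hmom hcov hK, Matrix.mul_smul, trace_smul, smul_eq_mul,
      Matrix.mul_assoc]

theorem norm_gainResidual_le_norm_matrixGrad (hn : 0 < n) (hQ : S.Q.PosDef) (hR : S.R.PosDef)
    (hmom : ∀ i, MemLp (fun x₀ : Fin n → ℝ => x₀ i) 2 S.law) (hcov : S.Sigma0.PosDef)
    (hK : K ∈ S.stabilizing) :
    2 * (sigmaMin S.Sigma0 * ‖S.gainResidual K‖) ≤ ‖matrixGrad S.cost K‖ := by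
  rw [matrixGrad_cost hn hQ hR hmom hcov hK, norm_smul, Real.norm_two]
  gcongr
  exact mul_norm_le_norm_mul (hcov.sigmaMin_pos hn).le (posSemidef_SigmaK_sub hn hmom hcov hK) _

/-! ### Gradient dominance and quadratic growth -/

/-- `R + Bᵀ P_K B ≥ R ≥ σ_min(R)`, tested against `D Σ Dᵀ`. -/
theorem sigmaMin_mul_trace_le_trace_gainCurvature (hn : 0 < n) (hQ : S.Q.PosDef) (hR : S.R.PosDef)
    (hmom : ∀ i, MemLp (fun x₀ : Fin n → ℝ => x₀ i) 2 S.law) (hcov : S.Sigma0.PosDef)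
    (hK : K ∈ S.stabilizing) (hK' : K' ∈ S.stabilizing) (D : Matrix (Fin m) (Fin n) ℝ) :
    sigmaMin S.R * (Dᵀ * D * S.SigmaK K').trace
      ≤ (Dᵀ * S.gainCurvature K * D * S.SigmaK K').trace := by
  have h := (hR.posSemidef_sub_sigmaMin.add
    ((posSemidef_valueMatrix hQ hR hK).transpose_mul_mul S.B)).transpose_mul_mul D
  rw [sub_add_eq_add_sub] at h
  change (Dᵀ * (S.gainCurvature K - _) * D).PosSemidef at h
  rw [Matrix.mul_sub, Matrix.sub_mul, Matrix.mul_smul, Matrix.mul_one, Matrix.smul_mul] at h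
  have h1 := h.trace_mul_le_trace_mul (posDef_SigmaK hn hmom hcov hK').posSemidef
  rwa [Matrix.smul_mul, trace_smul, smul_eq_mul] at h1

/-- Completing the square in the exact expansion of the cost bounds the suboptimality gap by the
squared norm of `E_K`. -/
theorem cost_sub_cost_le_norm_gainResidual_sq (hn : 0 < n) (hm : 0 < m) (hQ : S.Q.PosDef)
    (hR : S.R.PosDef) (hmom : ∀ i, MemLp (fun x₀ : Fin n → ℝ => x₀ i) 2 S.law)
    (hcov : S.Sigma0.PosDef) (hK : K ∈ S.stabilizing) (hK' : K' ∈ S.stabilizing) :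
    sigmaMin S.R * (S.cost K - S.cost K')
      ≤ sigmaMax (S.SigmaK K') * ‖S.gainResidual K‖ ^ 2 := by
  have hr := hR.sigmaMin_pos hm
  have hX := posDef_SigmaK hn hmom hcov hK'
  have hexp := cost_sub_cost hn hQ hR hmom hcov hK hK'
  have hcurv := sigmaMin_mul_trace_le_trace_gainCurvature hn hQ hR hmom hcov hK hK' (K' - K)
  set D := K' - K
  set E := S.gainResidual K
  set X := S.SigmaK K'
  set r := sigmaMin S.R
  have h1 : (Eᵀ * E * X).trace ≤ sigmaMax X * ‖E‖ ^ 2 := by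
    have h := hX.isHermitian.posSemidef_sigmaMax_sub.trace_mul_le_trace_mul
      (posSemidef_transpose_mul_self E)
    rwa [trace_mul_comm, Matrix.smul_mul, Matrix.one_mul, trace_smul, ← frobenius_norm_sq,
      smul_eq_mul] at h
  -- Completing the square: the trace of `(r D + E)ᵀ (r D + E) X` is nonnegative.
  have h2 := (posSemidef_transpose_mul_self (r • D + E)).trace_mul_nonneg hX.posSemidef
  have h3 := trace_transpose_mul_mul_comm hX.isHermitian E D
  simp only [transpose_add, transpose_smul, Matrix.add_mul, Matrix.mul_add, Matrix.smul_mul,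
    Matrix.mul_smul, trace_add, trace_smul, smul_eq_mul, h3] at h2
  have h4 := mul_le_mul_of_nonneg_left hcurv hr.le
  have h5 : S.cost K - S.cost K' = -(2 * (Dᵀ * E * X).trace)
      - (Dᵀ * S.gainCurvature K * D * X).trace := by linarith
  rw [h5]
  linarith

theorem mu_pos (hn : 0 < n) (hm : 0 < m) (hR : S.R.PosDef)
    (hmom : ∀ i, MemLp (fun x₀ : Fin n → ℝ => x₀ i) 2 S.law) (hcov : S.Sigma0.PosDef)
    (hK : K ∈ S.stabilizing) : 0 < S.mu K :=
  div_pos (mul_pos (mul_pos two_pos (pow_pos (hcov.sigmaMin_pos hn) 2)) (hR.sigmaMin_pos hm))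
    ((posDef_SigmaK hn hmom hcov hK).sigmaMax_pos hn)

theorem isGradientDominant_cost (hn : 0 < n) (hm : 0 < m) (hQ : S.Q.PosDef) (hR : S.R.PosDef)
    (hmom : ∀ i, MemLp (fun x₀ : Fin n → ℝ => x₀ i) 2 S.law) (hcov : S.Sigma0.PosDef)
    {Kstar : Matrix (Fin m) (Fin n) ℝ} (hopt : IsOptimal S.cost S.stabilizing Kstar) :
    IsGradientDominant S.cost S.stabilizing Kstar (S.mu Kstar) 2 where
  pos := mu_pos hn hm hR hmom hcov hopt.1
  optimal := hopt
  contDiffOn := (analyticOnNhd_cost hn hmom).contDiffOn (isOpen_stabilizing hn).uniqueDiffOn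
  bound K hK := by
    have hs := hcov.sigmaMin_pos hn
    have hr := hR.sigmaMin_pos hm
    have hx := (posDef_SigmaK hn hmom hcov hopt.1).sigmaMax_pos hn
    have h1 := cost_sub_cost_le_norm_gainResidual_sq hn hm hQ hR hmom hcov hK hopt.1
    have h2 := norm_gainResidual_le_norm_matrixGrad hn hQ hR hmom hcov hK
    have h3 : (2 * (sigmaMin S.Sigma0 * ‖S.gainResidual K‖)) ^ 2 ≤ ‖matrixGrad S.cost K‖ ^ 2 := by
      gcongr
    have hmu : 1 / (2 * S.mu Kstar) = sigmaMax (S.SigmaK Kstar)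
        / (4 * sigmaMin S.Sigma0 ^ 2 * sigmaMin S.R) := by
      rw [mu]; field_simp; norm_num
    rw [hmu, div_mul_eq_mul_div, le_div_iff₀ (by positivity)]
    have h4 := mul_le_mul_of_nonneg_left h1 (by positivity : 0 ≤ 4 * sigmaMin S.Sigma0 ^ 2)
    have h5 := mul_le_mul_of_nonneg_left h3 hx.le
    linarith

theorem gainResidual_eq_zero_of_isOptimal (hn : 0 < n) (hQ : S.Q.PosDef) (hR : S.R.PosDef)
    (hmom : ∀ i, MemLp (fun x₀ : Fin n → ℝ => x₀ i) 2 S.law) (hcov : S.Sigma0.PosDef)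
    {Kstar : Matrix (Fin m) (Fin n) ℝ} (hopt : IsOptimal S.cost S.stabilizing Kstar) :
    S.gainResidual Kstar = 0 := by
  have hloc : IsLocalMin S.cost Kstar :=
    hopt.2.isLocalMin ((isOpen_stabilizing hn).mem_nhds hopt.1)
  have hgrad : matrixGrad S.cost Kstar = 0 := by
    ext i j
    exact DFunLike.congr_fun hloc.fderiv_eq_zero (single i j 1)
  have h := norm_gainResidual_le_norm_matrixGrad hn hQ hR hmom hcov hopt.1
  rw [hgrad, norm_zero] at h
  have hs := hcov.sigmaMin_pos hn
  have h0 : ‖S.gainResidual Kstar‖ ≤ 0 := by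
    by_contra hpos
    have := mul_pos hs (not_le.1 hpos)
    linarith
  exact norm_le_zero_iff.1 h0

/-- The cost grows quadratically around an optimal gain. -/
theorem mul_norm_sub_sq_le_cost_sub_cost (hn : 0 < n) (hm : 0 < m) (hQ : S.Q.PosDef)
    (hR : S.R.PosDef) (hmom : ∀ i, MemLp (fun x₀ : Fin n → ℝ => x₀ i) 2 S.law)
    (hcov : S.Sigma0.PosDef) {Kstar : Matrix (Fin m) (Fin n) ℝ}
    (hopt : IsOptimal S.cost S.stabilizing Kstar) (hK : K ∈ S.stabilizing) :
    sigmaMin S.R * sigmaMin S.Sigma0 * ‖K - Kstar‖ ^ 2 ≤ S.cost K - S.cost Kstar := by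
  have hexp := cost_sub_cost hn hQ hR hmom hcov hopt.1 hK
  rw [gainResidual_eq_zero_of_isOptimal hn hQ hR hmom hcov hopt, Matrix.mul_zero, Matrix.zero_mul,
    trace_zero, mul_zero, zero_add] at hexp
  rw [hexp, mul_assoc]
  exact (mul_le_mul_of_nonneg_left (norm_sq_le_trace_transpose_mul_self_mul_SigmaK hn hmom hcov hK _)
    (hR.sigmaMin_pos hm).le).trans
      (sigmaMin_mul_trace_le_trace_gainCurvature hn hQ hR hmom hcov hopt.1 hK _)

end LQRProblem

/-! ### Smoothness constants and descent in normed spaces -/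

section Descent

variable {X : Type*} [NormedAddCommGroup X] [NormedSpace ℝ X]

/-- On a compact set, an analytic function satisfies the quadratic upper bound with a constant given
by a bound of its second derivative. -/
theorem exists_quadratic_upper_bound {J : X → ℝ} {U C : Set X} (hJ : AnalyticOnNhd ℝ J U)
    (hC : IsCompact C) (hCU : C ⊆ U) :
    ∃ L : ℝ, 0 < L ∧ ∀ x y : X, (∀ t ∈ Set.Icc (0 : ℝ) 1, t • x + (1 - t) • y ∈ C) →
      J y ≤ J x + fderiv ℝ J x (y - x) + L / 2 * ‖y - x‖ ^ 2 := by
  have hcont : ContinuousOn (fderiv ℝ (fderiv ℝ J)) C := hJ.fderiv.fderiv.continuousOn.mono hCU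
  obtain ⟨M, hM⟩ := hC.exists_bound_of_continuousOn (E := X →L[ℝ] X →L[ℝ] ℝ) hcont
  refine ⟨2 * (|M| + 1), by positivity, fun x y hxy => ?_⟩
  have hseg : segment ℝ y x ⊆ C := by
    rw [segment_symm, segment_eq_image]
    rintro _ ⟨t, ht, rfl⟩
    simpa using hxy (1 - t) ⟨by linarith [ht.2], by linarith [ht.1]⟩
  have hlip : ∀ z ∈ segment ℝ y x, ‖fderiv ℝ J z - fderiv ℝ J x‖ ≤ (|M| + 1) * ‖y - x‖ := by
    intro z hz
    have h := (convex_segment y x).norm_image_sub_le_of_norm_fderiv_le (𝕜 := ℝ) (f := fderiv ℝ J)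
      (C := |M| + 1) (fun w hw => (hJ.fderiv w (hCU (hseg hw))).differentiableAt)
      (fun w hw => (hM w (hseg hw)).trans (by linarith [le_abs_self M]))
      (right_mem_segment ℝ y x) hz
    refine h.trans ?_
    gcongr
    exact norm_sub_le_of_mem_segment (segment_symm ℝ y x ▸ hz)
  have h := (convex_segment y x).norm_image_sub_le_of_norm_fderiv_le' (𝕜 := ℝ)
    (φ := fderiv ℝ J x)
    (fun w hw => (hJ w (hCU (hseg hw))).differentiableAt) hlip (right_mem_segment ℝ y x)
    (left_mem_segment ℝ y x)
  rw [Real.norm_eq_abs] at h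
  have := (le_abs_self _).trans h
  linarith

/-- A step of length at most `1 / L` along a descent direction `v` of squared length equal to minus
the slope stays in the sublevel set and decreases the function. The quadratic upper bound is only
available for segments inside the sublevel set, so the first exit from it has to be excluded: at
such a point the bound forces the value to be strictly below the level. -/
theorem descent_step {J : X → ℝ} {U : Set X} {c L α : ℝ} {x v : X} (hU : IsOpen U)
    (hcont : ContinuousOn J U) (hclosed : IsClosed {y | y ∈ U ∧ J y ≤ c})
    (hL : 0 < L) (hα : 0 < α) (hαL : α ≤ 1 / L) (hxU : x ∈ U) (hxc : J x ≤ c)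
    (hd : DifferentiableAt ℝ J x) (hv : fderiv ℝ J x v = -‖v‖ ^ 2)
    (hbound : ∀ y, (∀ t ∈ Set.Icc (0 : ℝ) 1, t • x + (1 - t) • y ∈ {y | y ∈ U ∧ J y ≤ c}) →
      J y ≤ J x + fderiv ℝ J x (y - x) + L / 2 * ‖y - x‖ ^ 2) :
    (x + α • v ∈ U) ∧ J (x + α • v) ≤ J x - α / 2 * ‖v‖ ^ 2 := by
  rcases eq_or_ne v 0 with rfl | hv0
  · simpa using hxU
  have hvpos : 0 < ‖v‖ ^ 2 := by positivity
  have hLα : L * α ≤ 1 := by rwa [le_div_iff₀ hL, mul_comm] at hαL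
  set C := {y | y ∈ U ∧ J y ≤ c} with hCdef
  have hline : Continuous fun s : ℝ => x + s • v := by fun_prop
  have hdec : ∀ s ∈ Set.Icc (0 : ℝ) α, (∀ r ∈ Set.Icc (0 : ℝ) s, x + r • v ∈ C) →
      J (x + s • v) ≤ J x - s / 2 * ‖v‖ ^ 2 := by
    intro s hs hseg
    have h := hbound (x + s • v) fun t ht => by
      have e : t • x + (1 - t) • (x + s • v) = x + ((1 - t) * s) • v := by module
      rw [e]
      exact hseg _ ⟨mul_nonneg (by linarith [ht.2]) hs.1,
        mul_le_of_le_one_left hs.1 (by linarith [ht.1])⟩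
    rw [add_sub_cancel_left, map_smul, smul_eq_mul, hv, norm_smul, Real.norm_eq_abs, mul_pow,
      sq_abs] at h
    have h1 : L * s ≤ 1 := (mul_le_mul_of_nonneg_left hs.2 hL.le).trans hLα
    have h2 := mul_le_mul_of_nonneg_right h1 (mul_nonneg hs.1 hvpos.le)
    linarith
  have hext : ∀ s ∈ Set.Icc (0 : ℝ) α, (∀ r ∈ Set.Icc (0 : ℝ) s, x + r • v ∈ C) →
      ∀ᶠ r in 𝓝[>] s, x + r • v ∈ C := by
    intro s hs hseg
    have hsC : x + s • v ∈ C := hseg s ⟨hs.1, le_rfl⟩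
    have hUev : ∀ᶠ r in 𝓝[>] s, x + r • v ∈ U :=
      nhdsWithin_le_nhds (hline.continuousAt.eventually (hU.mem_nhds hsC.1))
    have hJev : ∀ᶠ r in 𝓝[>] s, J (x + r • v) ≤ c := by
      rcases hs.1.eq_or_lt with rfl | hs0
      · -- The start may lie on the level itself, where only the negative slope helps.
        have hder := hasDerivAt_iff_tendsto_slope_zero.1 (hd.hasFDerivAt.hasLineDerivAt v)
        rw [hv] at hder
        have hneg := hder.eventually (gt_mem_nhds (neg_lt_zero.2 hvpos))
        filter_upwards [hneg.filter_mono (nhdsWithin_mono _ fun r hr => ne_of_gt hr),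
          self_mem_nhdsWithin] with r hr hr0
        simp only [zero_add, zero_smul, add_zero, smul_eq_mul] at hr
        have := (pos_iff_neg_of_mul_neg hr).1 (inv_pos.2 hr0)
        linarith
      · have hlt : J (x + s • v) < c := by
          have := hdec s hs hseg
          have := mul_pos (half_pos hs0) hvpos
          linarith
        have hc : ContinuousAt (fun r : ℝ => J (x + r • v)) s :=
          ContinuousAt.comp (f := fun r : ℝ => x + r • v)
            (hcont.continuousAt (hU.mem_nhds hsC.1)) hline.continuousAt
        filter_upwards [nhdsWithin_le_nhds (hc.eventually (gt_mem_nhds hlt))] with r hr using hr.le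
    filter_upwards [hUev, hJev] with r h1 h2 using ⟨h1, h2⟩
  have hall : ∀ r ∈ Set.Icc (0 : ℝ) α, x + r • v ∈ C := by
    by_contra! hbad
    set B := {r | r ∈ Set.Icc (0 : ℝ) α ∧ x + r • v ∉ C} with hB
    have hBne : B.Nonempty := hbad
    have hBbdd : BddBelow B := ⟨0, fun r hr => hr.1.1⟩
    set s := sInf B
    have hs0 : 0 ≤ s := le_csInf hBne fun r hr => hr.1.1
    have hsα : s ≤ α := (csInf_le hBbdd hBne.some_mem).trans hBne.some_mem.1.2
    have hlt : Set.Ico 0 s ⊆ {r | x + r • v ∈ C} := by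
      intro r hr
      by_contra hrC
      exact absurd (csInf_le hBbdd (show r ∈ B from ⟨⟨hr.1, hr.2.le.trans hsα⟩, hrC⟩))
        (not_le.2 hr.2)
    have hle : ∀ r ∈ Set.Icc (0 : ℝ) s, x + r • v ∈ C := by
      rcases hs0.eq_or_lt with h0 | hpos
      · intro r hr
        rw [← h0] at hr
        obtain rfl : r = 0 := le_antisymm hr.2 hr.1
        simpa using ⟨hxU, hxc⟩
      · have := closure_minimal hlt (hclosed.preimage hline)
        rw [closure_Ico hpos.ne] at this
        exact fun r hr => this hr
    obtain ⟨b, hb, hbC⟩ := mem_nhdsGT_iff_exists_Ioo_subset.1 (hext s ⟨hs0, hsα⟩ hle)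
    have hge : b ≤ s := le_csInf hBne fun r hr => by
      by_contra hrb
      rcases le_or_gt r s with h | h
      · exact hr.2 (hle r ⟨hr.1.1, h⟩)
      · exact hr.2 (hbC ⟨h, not_le.1 hrb⟩)
    exact absurd hb (not_lt.2 hge)
  exact ⟨(hall α ⟨hα.le, le_rfl⟩).1, hdec α ⟨hα.le, le_rfl⟩ hall⟩

/-- A sequence of nonnegative numbers that contracts by the factor `q` decays geometrically; for
`q < 0` it vanishes identically. -/
theorem le_pow_mul_of_succ_le_mul {a : ℕ → ℝ} {q : ℝ} (ha : ∀ k, 0 ≤ a k)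
    (h : ∀ k, a (k + 1) ≤ q * a k) (k : ℕ) : a k ≤ q ^ k * a 0 := by
  rcases le_or_gt 0 q with hq | hq
  · induction k with
    | zero => simp
    | succ k ih =>
      rw [pow_succ', mul_assoc]
      exact (h k).trans (mul_le_mul_of_nonneg_left ih hq)
  · have hz : ∀ k, a k = 0 := fun k => by
      refine le_antisymm ?_ (ha k)
      by_contra hpos
      have := mul_neg_of_neg_of_pos hq (not_le.1 hpos)
      linarith [h k, ha (k + 1)]
    simp [hz]

end Descent

/-! ### Convergence of gradient descent -/

namespace LQRProblem

variable {n m : ℕ} {S : LQRProblem n m}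

theorem exists_isSmoothnessConstant_cost (hn : 0 < n) (hm : 0 < m) (hQ : S.Q.PosDef)
    (hR : S.R.PosDef) (hmom : ∀ i, MemLp (fun x₀ : Fin n → ℝ => x₀ i) 2 S.law)
    (hcov : S.Sigma0.PosDef) (c : ℝ) :
    ∃ L, IsSmoothnessConstant S.cost (sublevelSet S.cost S.stabilizing c) L := by
  obtain ⟨L, hL, h⟩ := exists_quadratic_upper_bound (analyticOnNhd_cost hn hmom)
    (isCompact_sublevelSet_cost hn hm hQ hR hmom hcov c) fun K hK => hK.1
  refine ⟨L, hL, fun K K' hseg => ?_⟩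
  rw [← fderiv_apply_eq_trace_matrixGrad]
  exact h K K' hseg

/-- A gradient step from a point of the sublevel set stabilizes the system and decreases the cost. -/
theorem gradient_step (hn : 0 < n) (hm : 0 < m) (hQ : S.Q.PosDef)
    (hR : S.R.PosDef) (hmom : ∀ i, MemLp (fun x₀ : Fin n → ℝ => x₀ i) 2 S.law)
    (hcov : S.Sigma0.PosDef) {c L α : ℝ}
    (hL : IsSmoothnessConstant S.cost (sublevelSet S.cost S.stabilizing c) L) (hα : 0 < α)
    (hαL : α ≤ 1 / L) {K : Matrix (Fin m) (Fin n) ℝ}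
    (hK : K ∈ sublevelSet S.cost S.stabilizing c) :
    K - α • matrixGrad S.cost K ∈ S.stabilizing ∧
      S.cost (K - α • matrixGrad S.cost K)
        ≤ S.cost K - α / 2 * ‖matrixGrad S.cost K‖ ^ 2 := by
  have han := analyticOnNhd_cost hn hmom
  have h := descent_step (v := -matrixGrad S.cost K) (isOpen_stabilizing hn) han.continuousOn
    (isCompact_sublevelSet_cost hn hm hQ hR hmom hcov c).isClosed hL.pos hα hαL hK.1 hK.2
    (han K hK.1).differentiableAt
    (by
      rw [map_neg, norm_neg, frobenius_norm_sq]
      exact congrArg Neg.neg (fderiv_apply_eq_trace_matrixGrad _ _ _))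
    (fun K' hseg => by
      have hb := hL.bound K K' hseg
      rw [← fderiv_apply_eq_trace_matrixGrad] at hb
      exact hb)
  rwa [smul_neg, ← sub_eq_add_neg, norm_neg] at h

theorem gradient_descent_mem_sublevelSet (hn : 0 < n) (hm : 0 < m) (hQ : S.Q.PosDef)
    (hR : S.R.PosDef) (hmom : ∀ i, MemLp (fun x₀ : Fin n → ℝ => x₀ i) 2 S.law)
    (hcov : S.Sigma0.PosDef) {c L α : ℝ}
    (hL : IsSmoothnessConstant S.cost (sublevelSet S.cost S.stabilizing c) L) (hα : 0 < α)
    (hαL : α ≤ 1 / L) {K : ℕ → Matrix (Fin m) (Fin n) ℝ}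
    (hK0 : K 0 ∈ sublevelSet S.cost S.stabilizing c)
    (hstep : ∀ k, K (k + 1) = K k - α • matrixGrad S.cost (K k)) (k : ℕ) :
    K k ∈ sublevelSet S.cost S.stabilizing c := by
  induction k with
  | zero => exact hK0
  | succ k ih =>
    have h := gradient_step hn hm hQ hR hmom hcov hL hα hαL ih
    rw [← hstep k] at h
    refine ⟨h.1, h.2.trans (le_trans ?_ ih.2)⟩
    have : 0 ≤ α / 2 * ‖matrixGrad S.cost (K k)‖ ^ 2 := by positivity
    linarith

theorem gradient_descent_cost_sub_le (hn : 0 < n) (hm : 0 < m) (hQ : S.Q.PosDef)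
    (hR : S.R.PosDef) (hmom : ∀ i, MemLp (fun x₀ : Fin n → ℝ => x₀ i) 2 S.law)
    (hcov : S.Sigma0.PosDef) {c L α : ℝ}
    (hL : IsSmoothnessConstant S.cost (sublevelSet S.cost S.stabilizing c) L) (hα : 0 < α)
    (hαL : α ≤ 1 / L) {K : ℕ → Matrix (Fin m) (Fin n) ℝ}
    (hK0 : K 0 ∈ sublevelSet S.cost S.stabilizing c)
    (hstep : ∀ k, K (k + 1) = K k - α • matrixGrad S.cost (K k))
    {Kstar : Matrix (Fin m) (Fin n) ℝ} (hopt : IsOptimal S.cost S.stabilizing Kstar) (k : ℕ) :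
    S.cost (K k) - S.cost Kstar ≤
      (1 - S.mu Kstar * α) ^ k * (S.cost (K 0) - S.cost Kstar) := by
  have hmem := gradient_descent_mem_sublevelSet hn hm hQ hR hmom hcov hL hα hαL hK0 hstep
  refine le_pow_mul_of_succ_le_mul (a := fun k => S.cost (K k) - S.cost Kstar)
    (fun k => sub_nonneg.2 (hopt.2 (hmem k).1)) (fun k => ?_) k
  have h1 := (gradient_step hn hm hQ hR hmom hcov hL hα hαL (hmem k)).2
  rw [← hstep k] at h1
  have hdom := isGradientDominant_cost hn hm hQ hR hmom hcov hopt
  have h2 := hdom.bound (K k) (hmem k).1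
  rw [div_mul_eq_mul_div, one_mul, le_div_iff₀ (mul_pos two_pos hdom.pos)] at h2
  have h3 := mul_le_mul_of_nonneg_left h2 (half_pos hα).le
  linarith

/-- The gap of the values tends to `0`, and by quadratic growth it controls the distance to the
optimal gain. In particular the optimal gain is unique. -/
theorem tendsto_gradient_descent (hn : 0 < n) (hm : 0 < m) (hQ : S.Q.PosDef)
    (hR : S.R.PosDef) (hmom : ∀ i, MemLp (fun x₀ : Fin n → ℝ => x₀ i) 2 S.law)
    (hcov : S.Sigma0.PosDef) {c L α : ℝ}
    (hL : IsSmoothnessConstant S.cost (sublevelSet S.cost S.stabilizing c) L) (hα : 0 < α)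
    (hαL : α ≤ 1 / L) {K : ℕ → Matrix (Fin m) (Fin n) ℝ}
    (hK0 : K 0 ∈ sublevelSet S.cost S.stabilizing c)
    (hstep : ∀ k, K (k + 1) = K k - α • matrixGrad S.cost (K k))
    {Kstar : Matrix (Fin m) (Fin n) ℝ} (hopt : IsOptimal S.cost S.stabilizing Kstar) :
    Tendsto K atTop (𝓝 Kstar) := by
  have hmem := gradient_descent_mem_sublevelSet hn hm hQ hR hmom hcov hL hα hαL hK0 hstep
  have hrate := gradient_descent_cost_sub_le hn hm hQ hR hmom hcov hL hα hαL hK0 hstep hopt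
  have hrs := mul_pos (hR.sigmaMin_pos hm) (hcov.sigmaMin_pos hn)
  have hgrow := fun k => mul_norm_sub_sq_le_cost_sub_cost hn hm hQ hR hmom hcov hopt (hmem k).1
  have hnonneg : ∀ k, 0 ≤ S.cost (K k) - S.cost Kstar := fun k =>
    sub_nonneg.2 (hopt.2 (hmem k).1)
  have hlim : Tendsto (fun k => S.cost (K k) - S.cost Kstar) atTop (𝓝 0) := by
    rcases (hnonneg 0).eq_or_lt with h0 | hpos
    · refine tendsto_const_nhds.congr fun k => ?_
      have := hrate k
      rw [← h0, mul_zero] at this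
      exact le_antisymm (hnonneg k) this
    · -- A positive gap forces the contraction factor to be nonnegative.
      have hq0 : 0 ≤ 1 - S.mu Kstar * α := by
        have h1 := (hnonneg 1).trans (hrate 1)
        rw [pow_one] at h1
        exact nonneg_of_mul_nonneg_left h1 hpos
      have hq1 : 1 - S.mu Kstar * α < 1 := by
        linarith [mul_pos (mu_pos hn hm hR hmom hcov hopt.1) hα]
      have hgeo := (tendsto_pow_atTop_nhds_zero_of_lt_one hq0 hq1).mul_const
        (S.cost (K 0) - S.cost Kstar)
      rw [zero_mul] at hgeo
      exact squeeze_zero hnonneg hrate hgeo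
  have hsq : Tendsto (fun k => ‖K k - Kstar‖ ^ 2) atTop (𝓝 0) := by
    have h := hlim.const_mul (sigmaMin S.R * sigmaMin S.Sigma0)⁻¹
    rw [mul_zero] at h
    refine squeeze_zero (fun k => by positivity) (fun k => ?_) h
    rw [← div_eq_inv_mul, le_div_iff₀ hrs, mul_comm]
    exact hgrow k
  refine tendsto_iff_norm_sub_tendsto_zero.2 ?_
  have h := hsq.sqrt
  simpa only [Real.sqrt_sq (norm_nonneg _), Real.sqrt_zero] using h

end LQRProblem

theorem theorem2 {n m : ℕ} (hn : 0 < n) (hm : 0 < m) (S : LQRProblem n m)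
    (hQ : S.Q.PosDef) (hR : S.R.PosDef)
    (hprob : IsProbabilityMeasure S.law)
    (hmom : ∀ i, MemLp (fun x₀ : Fin n → ℝ => x₀ i) 2 S.law)
    (hcov : S.Sigma0.PosDef) :
    -- on stabilizing gains the cost is well defined and equals `tr (P_K Σ₀)`
    (∀ K ∈ S.stabilizing,
      (∀ x₀, Summable (S.stageCost K x₀)) ∧
      Integrable (fun x₀ => ∑' t, S.stageCost K x₀ t) S.law ∧
      (∃! P, S.IsLyapunovSolution K P) ∧
      ∀ P, S.IsLyapunovSolution K P → S.cost K = (P * S.Sigma0).trace) ∧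
    -- the cost is real analytic, hence twice continuously differentiable
    (AnalyticOnNhd ℝ S.cost S.stabilizing ∧ ContDiffOn ℝ 2 S.cost S.stabilizing) ∧
    -- the cost is coercive
    IsCoerciveOn S.cost S.stabilizing ∧
    -- an optimal gain exists as soon as there is a stabilizing gain
    (S.stabilizing.Nonempty → ∃ Kstar, IsOptimal S.cost S.stabilizing Kstar) ∧
    -- the cost is gradient dominant of degree two with the explicit constant
    (∀ Kstar, IsOptimal S.cost S.stabilizing Kstar →
      IsGradientDominant S.cost S.stabilizing Kstar (S.mu Kstar) 2) ∧
    -- gradient descent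
    (∀ K0 ∈ S.stabilizing,
      (∃ L, IsSmoothnessConstant S.cost (sublevelSet S.cost S.stabilizing (S.cost K0)) L) ∧
      ∀ L, IsSmoothnessConstant S.cost (sublevelSet S.cost S.stabilizing (S.cost K0)) L →
      ∀ α : ℝ, 0 < α → α ≤ 1 / L →
      ∀ K : ℕ → Matrix (Fin m) (Fin n) ℝ, K 0 = K0 →
        (∀ k, K (k + 1) = K k - α • matrixGrad S.cost (K k)) →
        (∀ k, K k ∈ S.stabilizing) ∧
        ∀ Kstar, IsOptimal S.cost S.stabilizing Kstar →
          (∀ k, S.cost (K k) - S.cost Kstar ≤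
            (1 - S.mu Kstar * α) ^ k * (S.cost K0 - S.cost Kstar)) ∧
          Tendsto K atTop (𝓝 Kstar)) := by
  have han := LQRProblem.analyticOnNhd_cost hn hmom
  refine ⟨fun K hK => ⟨fun x₀ => (LQRProblem.hasSum_stageCost hK x₀).summable, ?_, ?_, ?_⟩,
    ⟨han, han.contDiffOn (LQRProblem.isOpen_stabilizing hn).uniqueDiffOn⟩,
    LQRProblem.isCoerciveOn_cost hn hm hQ hR hmom hcov,
    LQRProblem.exists_isOptimal_cost hn hm hQ hR hmom hcov,
    fun Kstar hopt => LQRProblem.isGradientDominant_cost hn hm hQ hR hmom hcov hopt, ?_⟩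
  · simp only [(LQRProblem.hasSum_stageCost hK _).tsum_eq]
    exact LQRProblem.integrable_quadraticForm hmom _
  · exact ⟨S.valueMatrix K, (LQRProblem.isLyapunovSolution_iff hK _).2 rfl,
      fun P hP => (LQRProblem.isLyapunovSolution_iff hK P).1 hP⟩
  · intro P hP
    rw [(LQRProblem.isLyapunovSolution_iff hK P).1 hP]
    exact LQRProblem.cost_eq_trace_valueMatrix hmom hK
  · intro K0 hK0
    refine ⟨LQRProblem.exists_isSmoothnessConstant_cost hn hm hQ hR hmom hcov _, ?_⟩
    rintro L hL α hα hαL K rfl hstep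
    have hmem : K 0 ∈ sublevelSet S.cost S.stabilizing (S.cost (K 0)) := ⟨hK0, le_rfl⟩
    exact ⟨fun k => (LQRProblem.gradient_descent_mem_sublevelSet hn hm hQ hR hmom hcov hL hα hαL
        hmem hstep k).1,
      fun Kstar hopt => ⟨LQRProblem.gradient_descent_cost_sub_le hn hm hQ hR hmom hcov hL hα hαL
          hmem hstep hopt,
        LQRProblem.tendsto_gradient_descent hn hm hQ hR hmom hcov hL hα hαL hmem hstep hopt⟩⟩
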